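/- Let $k\ge 1$ and $n\ge 0$ be integers and let $a\in C^\infty(\mathbf R)$ be real valued with $a(0)=2n+1$. Fix $\delta_0>0$ and a cutoff $\zeta\in C_0^\infty(\mathbf R)$ with $\zeta=1$ for $|x|\le\delta_0$ and $\zeta$ supported in $\{|x|\le 2\delta_0\}$, and put $b(s)=(a(s)-a(0))\zeta(s)$. For real $z,\epsilon$ let $$B_{z,\epsilon}=-\partial_y^2+p_\epsilon(y)^2-[a(0)+b(z+\epsilon z y)]\,p_\epsilon'(y),\qquad p_\epsilon(y)=(\epsilon k)^{-1}\big((1+\epsilon y)^k-1\big)\ (\epsilon\ne0),\quad p_0(y)=y,$$ acting on $L^2(\mathbf R)$. Then there exist $\theta>0$ and $\epsilon_0>0$ such that for every real $\epsilon$ with $|\epsilon|<\epsilon_0$ the operator $B_{0,\epsilon}$ has exactly one eigenvalue $\lambda(0,\epsilon)$ in $[-\theta,\theta]$. This eigenvalue has an asymptotic expansion to all orders, $\lambda(0,\epsilon)\sim\sum_{j\ge0}\Lambda_j\epsilon^j$ as $\epsilon\to0$, that is, $\lambda(0,\epsilon)-\sum_{j<N}\Lambda_j\epsilon^j=O(|\epsilon|^N)$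 for every $N\ge 0$, and its coefficients satisfy $$\Lambda_1=0,\qquad \Lambda_2=\frac{(k-1)\,n(n+1)}{2}.$$ -/

import Mathlib

open scoped ContDiff

/-- `ζ` is a smooth cutoff function, equal to `1` where `|x| ≤ δ₀` and supported
where `|x| ≤ 2 δ₀`. -/
def IsCutoff (δ₀ : ℝ) (ζ : ℝ → ℝ) : Prop :=
  ContDiff ℝ ∞ ζ ∧ (∀ x, |x| ≤ δ₀ → ζ x = 1) ∧ tsupport ζ ⊆ {x | |x| ≤ 2 * δ₀}

/-- `b(s) = (a(s) - a(0)) ζ(s)`. -/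
def bFun (a ζ : ℝ → ℝ) (s : ℝ) : ℝ := (a s - a 0) * ζ s

/-- `p_ε(y) = (ε k)⁻¹ ((1 + ε y)^k - 1)`, extended by continuity to `p_0(y) = y`. -/
noncomputable def pFun (k : ℕ) (ε y : ℝ) : ℝ :=
  if ε = 0 then y else (ε * k)⁻¹ * ((1 + ε * y) ^ k - 1)

/-- The differential expression
`B_{z,ε} φ = -φ'' + (p_ε² - [a(0) + b(z + ε z y)] p_ε') φ`. -/
noncomputable def opB (k : ℕ) (a ζ : ℝ → ℝ) (z ε : ℝ) (φ : ℝ → ℝ) (y : ℝ) : ℝ :=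
  -iteratedDeriv 2 φ y +
    (pFun k ε y ^ 2 - (a 0 + bFun a ζ (z + ε * z * y)) * deriv (pFun k ε) y) * φ y

/-- `μ` is an eigenvalue of `B_{z,ε}` on `L²(ℝ)`: there is a nonzero square integrable
solution of `B_{z,ε} φ = μ φ`. The coefficients are real and smooth, so eigenfunctions may be
taken real valued and are classical solutions. -/
def IsEigenvalueB (k : ℕ) (a ζ : ℝ → ℝ) (z ε μ : ℝ) : Prop :=
  ∃ φ : ℝ → ℝ, ContDiff ℝ 2 φ ∧ MeasureTheory.MemLp φ 2 MeasureTheory.volume ∧ φ ≠ 0 ∧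
    ∀ y, opB k a ζ z ε φ y = μ * φ y

/-- `f(ε) ~ ∑_{j ≥ 0} c_j ε^j` as `ε → 0`. -/
def HasAsymptoticExpansionAtZero (f : ℝ → ℝ) (c : ℕ → ℝ) : Prop :=
  ∀ N : ℕ, (fun ε => f ε - ∑ j ∈ Finset.range N, c j * ε ^ j) =O[nhds (0 : ℝ)]
    (fun ε => ε ^ N)

/-! At `z = 0` the cutoff term is `b(0) = 0`, so the operator is `-∂² + V_ε` with `V_ε = p_ε² -
(2n+1) p_ε'`, a polynomial in `y` and `ε`. It is the oscillator `-∂² + y² - (2n+1)` at `ε = 0`,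
where the Hermite function `h` spans the kernel. The perturbation is unbounded, so the argument
avoids operator theory and shoots from both ends.

For small `ε`, `V_ε ≥ 1/2` outside a fixed interval (`exists_potential_lower_bound`). Hence for `|μ|
≤ θ` the equation has, up to scale, one solution decaying at `+∞`. The symmetry `V_{-ε}(-y) =
V_ε(y)` gives the one decaying at `-∞`. Both are close to `h` on `[-R, R]`
(`nonempty_shootingData`). A zero of their Wronskian is an eigenvalue.

Uniqueness: eigenfunctions for distinct eigenvalues are orthogonal, but two eigenfunctions close to
`h` on `[-R, R]` and of equal sign on the tails have positive inner product (`eigenvalue_unique`).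

Existence and expansion: formal perturbation theory in the space of polynomials times a Gaussian
gives, for every `N`, a quasimode `u` with quasi-eigenvalue `m_N = ∑_{j<N} Λ_j ε^j` and residual
`O(ε^N)` (`exists_quasimodes`). Green's identity on the two half-lines gives `W(μ) u(R) = (μ - m_N)
I - J` with `I` bounded below by a positive constant and `J = O(ε^N)` (`wronskian_mul_quasimode`).
So `W` changes sign within `O(ε^N)` of `m_N`, which produces an eigenvalue there
(`eventually_exists_eigenvalue`). By uniqueness it is the same eigenvalue for all `N`. The values of
`Λ_1` and `Λ_2` come from explicit correctors (`exists_second_order`). -/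

open MeasureTheory Filter Topology Set

/-! ### Linear differential equations -/

/-- Terms of the Picard series of the linear equation `x' = A x`, `x t₀ = x₀`. -/
noncomputable def picardTerm {E : Type*} [NormedAddCommGroup E] [NormedSpace ℝ E]
    (A : ℝ → E →L[ℝ] E) (t₀ : ℝ) (x₀ : E) : ℕ → ℝ → E
  | 0 => fun _ => x₀
  | j + 1 => fun t => ∫ s in t₀..t, A s (picardTerm A t₀ x₀ j s)

section Picard

variable {E : Type*} [NormedAddCommGroup E] [NormedSpace ℝ E] {A : ℝ → E →L[ℝ] E}
  {t₀ : ℝ} {x₀ : E}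

lemma continuous_picardTerm (hA : Continuous A) (j : ℕ) :
    Continuous (picardTerm A t₀ x₀ j) := by
  induction j with
  | zero => exact continuous_const
  | succ j ih =>
    exact intervalIntegral.continuous_primitive
      (fun a b => (hA.clm_apply ih).intervalIntegrable a b) t₀

lemma hasDerivAt_picardTerm_succ [CompleteSpace E] (hA : Continuous A) (j : ℕ) (t : ℝ) :
    HasDerivAt (picardTerm A t₀ x₀ (j + 1)) (A t (picardTerm A t₀ x₀ j t)) t := by
  have hc : Continuous fun s => A s (picardTerm A t₀ x₀ j s) :=
    hA.clm_apply (continuous_picardTerm hA j)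
  exact intervalIntegral.integral_hasDerivAt_right (hc.intervalIntegrable _ _)
    hc.aestronglyMeasurable.stronglyMeasurableAtFilter hc.continuousAt

/-- Each integration of the previous bound gains a factor `M |t - t₀| / (j + 1)`; the factorial
makes the Picard series converge uniformly on bounded intervals. -/
lemma norm_picardTerm_le (hA : Continuous A) {T M : ℝ} (hM : 0 ≤ M)
    (hb : ∀ t, |t - t₀| ≤ T → ‖A t‖ ≤ M) (j : ℕ) (t : ℝ) (ht : |t - t₀| ≤ T) :
    ‖picardTerm A t₀ x₀ j t‖ ≤ ‖x₀‖ * ((M * |t - t₀|) ^ j / j.factorial) := by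
  induction j generalizing t with
  | zero => simp [picardTerm]
  | succ j ih =>
    have h1 : ∀ s ∈ uIoc t₀ t, ‖A s (picardTerm A t₀ x₀ j s)‖ ≤
        (‖x₀‖ * M ^ (j + 1) / j.factorial) * |s - t₀| ^ j := by
      intro s hs
      have hs' : |s - t₀| ≤ T :=
        (abs_sub_left_of_mem_uIcc (uIoc_subset_uIcc hs)).trans ht
      calc ‖A s (picardTerm A t₀ x₀ j s)‖ ≤ ‖A s‖ * ‖picardTerm A t₀ x₀ j s‖ :=
            (A s).le_opNorm _
        _ ≤ M * (‖x₀‖ * ((M * |s - t₀|) ^ j / j.factorial)) := by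
            gcongr
            · exact hb s hs'
            · exact ih s hs'
        _ = _ := by rw [mul_pow]; ring
    have h2 : ‖picardTerm A t₀ x₀ (j + 1) t‖ ≤
        ∫ s in uIoc t₀ t, (‖x₀‖ * M ^ (j + 1) / j.factorial) * |s - t₀| ^ j := by
      refine (intervalIntegral.norm_integral_le_integral_norm_uIoc).trans ?_
      refine setIntegral_mono_on ?_ ?_ measurableSet_uIoc h1
      · exact ((hA.clm_apply (continuous_picardTerm hA j)).norm.integrableOn_uIcc).mono_set
          uIoc_subset_uIcc
      · exact (Continuous.integrableOn_uIcc (by fun_prop)).mono_set uIoc_subset_uIcc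
    refine h2.trans (le_of_eq ?_)
    rw [integral_const_mul, integral_pow_abs_sub_uIoc, mul_pow, Nat.factorial_succ]
    push_cast
    field_simp

/-- A linear equation `x' = A x` with continuous coefficients has a global solution. -/
theorem exists_linear_ode_solution [CompleteSpace E] (hA : Continuous A) (t₀ : ℝ) (x₀ : E) :
    ∃ x : ℝ → E, x t₀ = x₀ ∧ ∀ t, HasDerivAt x (A t (x t)) t := by
  have hz : ∀ j, picardTerm A t₀ x₀ (j + 1) t₀ = 0 := fun j => by simp [picardTerm]
  have hs0 : Summable fun j => picardTerm A t₀ x₀ j t₀ :=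
    summable_of_ne_finset_zero (s := {0}) fun j hj => by
      obtain ⟨i, rfl⟩ := Nat.exists_eq_succ_of_ne_zero (by simpa using hj)
      exact hz i
  refine ⟨fun t => ∑' j, picardTerm A t₀ x₀ j t, ?_, fun t => ?_⟩
  · change ∑' j, picardTerm A t₀ x₀ j t₀ = x₀
    rw [tsum_eq_single 0 (fun j hj => ?_)]
    · rfl
    · obtain ⟨i, rfl⟩ := Nat.exists_eq_succ_of_ne_zero hj
      exact hz i
  set T := |t - t₀| + 1
  have hT : 0 < T := by positivity
  obtain ⟨M, hMb⟩ := (isCompact_closedBall t₀ T).exists_bound_of_continuousOn hA.continuousOn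
  have hb : ∀ s, |s - t₀| ≤ T → ‖A s‖ ≤ M := fun s hs =>
    hMb s (by simpa [Real.dist_eq] using hs)
  have hM : 0 ≤ M := (norm_nonneg _).trans (hb t₀ (by simp [hT.le]))
  have hbound : ∀ j s, |s - t₀| ≤ T →
      ‖picardTerm A t₀ x₀ j s‖ ≤ ‖x₀‖ * ((M * T) ^ j / j.factorial) := fun j s hs => by
    refine (norm_picardTerm_le hA hM hb j s hs).trans ?_
    gcongr
  have hsum : Summable fun j : ℕ => ‖x₀‖ * ((M * T) ^ j / j.factorial) :=
    (Real.summable_pow_div_factorial _).mul_left _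
  have htT : |t - t₀| ≤ T := by simp [T]
  have hst : Summable fun j => picardTerm A t₀ x₀ j t :=
    Summable.of_norm_bounded hsum fun j => hbound j t htT
  -- The derivative of term `j + 1` is `A` applied to term `j`; this index shift makes the sum of
  -- the derivatives equal to `A` applied to the sum.
  let g' : ℕ → ℝ → E := fun j s => match j with
    | 0 => 0
    | j + 1 => A s (picardTerm A t₀ x₀ j s)
  let u : ℕ → ℝ := fun j => match j with
    | 0 => 0
    | j + 1 => M * (‖x₀‖ * ((M * T) ^ j / j.factorial))
  have hu : Summable u := (summable_nat_add_iff 1).1 (hsum.mul_left M)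
  have key := hasDerivAt_tsum_of_isPreconnected (g := fun j => picardTerm A t₀ x₀ j) (g' := g')
    (t := Metric.ball t₀ T) (y₀ := t₀) (y := t) hu Metric.isOpen_ball
    (convex_ball t₀ T).isPreconnected ?_ ?_ (Metric.mem_ball_self hT) hs0
    (by simp [Real.dist_eq, T])
  · convert key using 1
    rw [(A t).map_tsum hst]
    have hg : Summable fun j => g' j t :=
      (summable_nat_add_iff 1).1 ((A t).summable hst)
    rw [hg.tsum_eq_zero_add]
    simp [g']
  · rintro (_ | j) y -
    · exact hasDerivAt_const y x₀
    · exact hasDerivAt_picardTerm_succ hA j y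
  · rintro (_ | j) y hy
    · simp [g', u]
    · have hy' : |y - t₀| ≤ T := by
        have := (Metric.mem_ball.1 hy).le
        rwa [Real.dist_eq] at this
      refine ((A y).le_opNorm _).trans ?_
      exact mul_le_mul (hb y hy') (hbound j y hy') (norm_nonneg _) hM

end Picard

/-- `f` is a solution of `f'' = q f` on the line with derivative `f'`. -/
structure IsSol (q f f' : ℝ → ℝ) : Prop where
  deriv₁ : ∀ y, HasDerivAt f (f' y) y
  deriv₂ : ∀ y, HasDerivAt f' (q y * f y) y

namespace IsSol

variable {q q₁ q₂ f f' g g' : ℝ → ℝ}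

lemma continuous (h : IsSol q f f') : Continuous f :=
  continuous_iff_continuousAt.2 fun y => (h.deriv₁ y).continuousAt

lemma const_mul (h : IsSol q f f') (c : ℝ) :
    IsSol q (fun y => c * f y) (fun y => c * f' y) :=
  ⟨fun y => (h.deriv₁ y).const_mul c, fun y =>
    ((h.deriv₂ y).const_mul c).congr_deriv (by ring)⟩

lemma sub (h : IsSol q f f') (h' : IsSol q g g') :
    IsSol q (fun y => f y - g y) (fun y => f' y - g' y) :=
  ⟨fun y => (h.deriv₁ y).sub (h'.deriv₁ y), fun y =>
    ((h.deriv₂ y).sub (h'.deriv₂ y)).congr_deriv (by ring)⟩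

lemma comp_neg (h : IsSol q f f') :
    IsSol (fun y => q (-y)) (fun y => f (-y)) (fun y => -f' (-y)) := by
  refine ⟨fun y => ?_, fun y => ?_⟩
  · exact ((h.deriv₁ (-y)).comp y (hasDerivAt_neg y)).congr_deriv (by ring)
  · exact ((h.deriv₂ (-y)).comp y (hasDerivAt_neg y)).neg.congr_deriv (by ring)

/-- The derivative of the Wronskian. -/
lemma hasDerivAt_wronskian (h : IsSol q₁ f f') (h' : IsSol q₂ g g') (y : ℝ) :
    HasDerivAt (fun y => f y * g' y - f' y * g y) ((q₂ y - q₁ y) * (f y * g y)) y :=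
  (((h.deriv₁ y).mul (h'.deriv₂ y)).sub ((h.deriv₂ y).mul (h'.deriv₁ y))).congr_deriv (by ring)

theorem exists_solution (hq : Continuous q) (t₀ α β : ℝ) :
    ∃ f f', IsSol q f f' ∧ f t₀ = α ∧ f' t₀ = β := by
  let A : ℝ → (ℝ × ℝ) →L[ℝ] ℝ × ℝ := fun t =>
    (ContinuousLinearMap.snd ℝ ℝ ℝ).prod (q t • ContinuousLinearMap.fst ℝ ℝ ℝ)
  have hA : Continuous A := by
    have h1 : Continuous fun t => q t • ContinuousLinearMap.fst ℝ ℝ ℝ := by fun_prop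
    exact (ContinuousLinearMap.prodₗᵢ (E := ℝ × ℝ) (F := ℝ) (G := ℝ) (𝕜 := ℝ) ℝ).continuous.comp
      (continuous_const.prodMk h1)
  obtain ⟨x, hx0, hx⟩ := exists_linear_ode_solution hA t₀ (α, β)
  refine ⟨fun t => (x t).1, fun t => (x t).2, ⟨fun y => ?_, fun y => ?_⟩, by simp [hx0],
    by simp [hx0]⟩
  · exact (hx y).fst
  · exact (hx y).snd

/-- Gronwall comparison of solutions of two equations. -/
theorem gronwall {a b M η δ : ℝ} (h₁ : IsSol q₁ f f') (h₂ : IsSol q₂ g g')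
    (hM : ∀ x ∈ Icc a b, |q₁ x| ≤ M) (hη : ∀ x ∈ Icc a b, |q₁ x - q₂ x| * |g x| ≤ η)
    (hδ : |f a - g a| ≤ δ) (hδ' : |f' a - g' a| ≤ δ) {x : ℝ} (hx : x ∈ Icc a b) :
    |f x - g x| ≤ (δ + η) * Real.exp ((M + 1) * (b - a)) ∧
      |f' x - g' x| ≤ (δ + η) * Real.exp ((M + 1) * (b - a)) := by
  have hM0 : 0 ≤ M := (abs_nonneg _).trans (hM x hx)
  have hη0 : 0 ≤ η := (by positivity : 0 ≤ |q₁ x - q₂ x| * |g x|).trans (hη x hx)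
  have hδ0 : 0 ≤ δ := (abs_nonneg _).trans hδ
  have hd : ∀ t, HasDerivAt (fun t => (f t - g t, f' t - g' t))
      (f' t - g' t, q₁ t * f t - q₂ t * g t) t := fun t =>
    ((h₁.deriv₁ t).sub (h₂.deriv₁ t)).prodMk ((h₁.deriv₂ t).sub (h₂.deriv₂ t))
  have key := norm_le_gronwallBound_of_norm_deriv_right_le (K := M + 1) (ε := η) (δ := δ)
    (a := a) (b := b)
    (continuous_iff_continuousAt.2 fun t => (hd t).continuousAt).continuousOn
    (fun t _ => (hd t).hasDerivWithinAt) (by simp [Prod.norm_def, hδ, hδ']) ?_ x hx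
  · have hle : gronwallBound δ (M + 1) η (x - a) ≤ (δ + η) * Real.exp ((M + 1) * (b - a)) := by
      rw [gronwallBound_of_K_ne_0 (by positivity)]
      have h1 : Real.exp ((M + 1) * (x - a)) ≤ Real.exp ((M + 1) * (b - a)) := by
        gcongr; exact hx.2
      have h2 : η / (M + 1) ≤ η := div_le_self hη0 (by linarith)
      have h3 : 0 ≤ Real.exp ((M + 1) * (x - a)) - 1 :=
        sub_nonneg.2 (Real.one_le_exp (mul_nonneg (by positivity) (sub_nonneg.2 hx.1)))
      calc _ ≤ δ * Real.exp ((M + 1) * (b - a)) + η * Real.exp ((M + 1) * (b - a)) := by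
            refine add_le_add (mul_le_mul_of_nonneg_left h1 hδ0) ?_
            exact mul_le_mul h2 (by linarith) h3 hη0
        _ = _ := by ring
    have h2 := key.trans hle
    rw [Prod.norm_def] at h2
    exact ⟨(le_max_left _ _).trans h2, (le_max_right _ _).trans h2⟩
  · intro t ht
    have ht' : t ∈ Icc a b := ⟨ht.1, ht.2.le⟩
    have n1 : |f t - g t| ≤ ‖(f t - g t, f' t - g' t)‖ := norm_fst_le (f t - g t, f' t - g' t)
    have n2 : |f' t - g' t| ≤ ‖(f t - g t, f' t - g' t)‖ := norm_snd_le (f t - g t, f' t - g' t)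
    have n0 := norm_nonneg (f t - g t, f' t - g' t)
    rw [Prod.norm_def]
    refine max_le ?_ ?_
    · simp only [Real.norm_eq_abs]; nlinarith
    · simp only [Real.norm_eq_abs]
      have : q₁ t * f t - q₂ t * g t = q₁ t * (f t - g t) + (q₁ t - q₂ t) * g t := by ring
      rw [this]
      refine (abs_add_le _ _).trans ?_
      rw [abs_mul, abs_mul]
      have := mul_le_mul (hM t ht') n1 (abs_nonneg _) hM0
      have := hη t ht'
      linarith

/-- Gronwall against the zero solution with zero initial and coefficient errors; points to the left
of `a` are reached by reflection. -/
theorem eq_zero (hq : Continuous q) (h : IsSol q f f') {a : ℝ} (h0 : f a = 0)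
    (h0' : f' a = 0) : ∀ y, f y = 0 := by
  have aux : ∀ {q f f' : ℝ → ℝ} {a : ℝ}, Continuous q → IsSol q f f' → f a = 0 → f' a = 0 →
      ∀ y, a ≤ y → f y = 0 := by
    intro q f f' a hq h h0 h0' y hy
    obtain ⟨M, hM⟩ := (isCompact_Icc (a := a) (b := y)).exists_bound_of_continuousOn
      hq.continuousOn
    have hz : IsSol q (fun _ => 0) (fun _ => 0) :=
      ⟨fun _ => hasDerivAt_const _ _, fun y => by simpa using hasDerivAt_const y (0 : ℝ)⟩
    have := (h.gronwall hz (δ := 0) (η := 0) hM (by simp) (by simp [h0]) (by simp [h0'])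
      (right_mem_Icc.2 hy)).1
    simpa using this
  intro y
  rcases le_total a y with hy | hy
  · exact aux hq h h0 h0' y hy
  · have := aux (hq.comp continuous_neg) h.comp_neg (a := -a) (by simpa) (by simpa)
      (-y) (by linarith)
    simpa using this

/-- Two solutions with vanishing Wronskian are proportional. -/
theorem proportional (hq : Continuous q) (h : IsSol q f f') (h' : IsSol q g g') {a : ℝ}
    (hg : g a ≠ 0) (hW : f a * g' a - f' a * g a = 0) (y : ℝ) :
    f y = f a / g a * g y := by
  have := eq_zero hq (h.sub (h'.const_mul (f a / g a))) (a := a) (by field_simp; ring)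
    (by field_simp; linarith) y
  linarith

end IsSol

/-! ### Decaying solutions on a half-line -/

lemma monotoneOn_Ici_of_hasDerivAt_nonneg {g g' : ℝ → ℝ} {a : ℝ}
    (hd : ∀ y, HasDerivAt g (g' y) y) (h : ∀ y, a ≤ y → 0 ≤ g' y) : MonotoneOn g (Ici a) := by
  refine monotoneOn_of_deriv_nonneg (convex_Ici a)
    (fun y _ => (hd y).continuousAt.continuousWithinAt)
    (fun y _ => (hd y).differentiableAt.differentiableWithinAt) fun y hy => ?_
  rw [(hd y).deriv]
  exact h y (interior_subset hy)

lemma integrableOn_Ioi_deriv_of_nonneg_of_le {g g' : ℝ → ℝ} {a C : ℝ}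
    (hd : ∀ y, HasDerivAt g (g' y) y) (h : ∀ y, a ≤ y → 0 ≤ g' y)
    (hC : ∀ y, a ≤ y → g y ≤ C) : IntegrableOn g' (Ioi a) := by
  have hm := monotoneOn_Ici_of_hasDerivAt_nonneg hd h
  have hmono : Monotone fun y => g (max a y) := fun x y hxy =>
    hm (mem_Ici.2 (le_max_left _ _)) (mem_Ici.2 (le_max_left _ _)) (max_le_max le_rfl hxy)
  have hlim := tendsto_atTop_ciSup hmono
    ⟨C, by rintro _ ⟨y, rfl⟩; exact hC _ (le_max_left _ _)⟩
  refine integrableOn_Ioi_deriv_of_nonneg' (l := ⨆ y, g (max a y)) (fun y _ => hd y)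
    (fun y hy => h y (le_of_lt hy)) (hlim.congr' ?_)
  filter_upwards [eventually_ge_atTop a] with y hy
  rw [max_eq_right hy]

lemma not_integrableOn_Ioi_of_le {g : ℝ → ℝ} {a b η : ℝ} (hη : 0 < η)
    (h : ∀ y, b ≤ y → η ≤ g y) : ¬ IntegrableOn g (Ioi a) := by
  intro hi
  have h1 : IntegrableOn (fun _ : ℝ => η) (Ioi (max a b)) := by
    refine Integrable.mono' (hi.mono_set (Ioi_subset_Ioi (le_max_left a b)))
      aestronglyMeasurable_const ?_
    filter_upwards [ae_restrict_mem measurableSet_Ioi] with y hy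
    rw [Real.norm_of_nonneg hη.le]
    exact h y ((le_max_right a b).trans (le_of_lt hy))
  rw [integrableOn_const_iff] at h1
  simp [hη.ne'] at h1

namespace IsSol

variable {q q₁ q₂ f f' g g' : ℝ → ℝ}

/-- The derivative of `f f'` is `f'² + q f²`. This convexity is what separates growing from decaying
solutions below. -/
lemma monotoneOn_mul_deriv (h : IsSol q f f') {a : ℝ} (hq : ∀ y, a ≤ y → 0 ≤ q y) :
    MonotoneOn (fun y => f y * f' y) (Ici a) :=
  monotoneOn_Ici_of_hasDerivAt_nonneg (fun y => (h.deriv₁ y).mul (h.deriv₂ y)) fun y hy => by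
    nlinarith [mul_self_nonneg (f' y), mul_nonneg (hq y hy) (mul_self_nonneg (f y))]

lemma monotoneOn_sq (h : IsSol q f f') {a : ℝ} (hq : ∀ y, a ≤ y → 0 ≤ q y)
    (h0 : 0 ≤ f a * f' a) : MonotoneOn (fun y => f y * f y) (Ici a) :=
  monotoneOn_Ici_of_hasDerivAt_nonneg (fun y => (h.deriv₁ y).mul (h.deriv₁ y)) fun y hy => by
    have := h.monotoneOn_mul_deriv hq self_mem_Ici hy hy
    simp only at this
    linarith

/-- A zero of `f` would contradict the monotonicity of `f²`, and the sign of `f'` then follows from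
that of `f f'`. -/
lemma pos_of_pos (h : IsSol q f f') {a : ℝ} (hq : ∀ y, a ≤ y → 0 ≤ q y) (h0 : 0 < f a)
    (h0' : 0 ≤ f' a) {y : ℝ} (hy : a ≤ y) : 0 < f y ∧ 0 ≤ f' y := by
  have hf : 0 < f y := by
    by_contra! hle
    obtain ⟨x, hx, hx0⟩ := intermediate_value_Icc' hy h.continuous.continuousOn ⟨hle, h0.le⟩
    have := h.monotoneOn_sq hq (by positivity) self_mem_Ici hx.1 hx.1
    simp only [hx0] at this
    nlinarith
  have := h.monotoneOn_mul_deriv hq self_mem_Ici hy hy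
  simp only at this
  refine ⟨hf, ?_⟩
  by_contra! hlt
  nlinarith [mul_nonneg h0.le h0']

end IsSol

/-- `f` is a positive solution of `f'' = q f` on `[R, ∞)` decaying at infinity. -/
structure IsDecaying (q : ℝ → ℝ) (R : ℝ) (f f' : ℝ → ℝ) : Prop extends IsSol q f f' where
  pos : ∀ y, R ≤ y → 0 < f y
  le : ∀ y, R ≤ y → f y ≤ f R
  integrableOn : IntegrableOn f (Ioi R)
  tendsto : Tendsto f atTop (𝓝 0)
  tendsto' : Tendsto f' atTop (𝓝 0)

namespace IsDecaying

variable {q q₁ q₂ f f' g g' : ℝ → ℝ} {R c : ℝ}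

/-- If `q ≥ 0` on `[R, ∞)` there is a positive nonincreasing solution on `[R, ∞)`. -/
lemma exists_pos_antitone (hq : Continuous q) (hq0 : ∀ y, R ≤ y → 0 ≤ q y) :
    ∃ f f', IsSol q f f' ∧ ∀ y, R ≤ y → 0 < f y ∧ f' y ≤ 0 := by
  obtain ⟨ψ, ψ', hψ, hψR, hψR'⟩ := IsSol.exists_solution hq R 1 0
  obtain ⟨χ, χ', hχ, hχR, hχR'⟩ := IsSol.exists_solution hq R 1 1
  have hψp : ∀ y, R ≤ y → 0 < ψ y := fun y hy =>
    (hψ.pos_of_pos hq0 (by simp [hψR]) (by simp [hψR']) hy).1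
  have hχp : ∀ y, R ≤ y → 0 < χ y ∧ 0 ≤ χ' y := fun y hy =>
    hχ.pos_of_pos hq0 (by simp [hχR]) (by simp [hχR']) hy
  have hW : ∀ y, ψ y * χ' y - ψ' y * χ y = 1 := fun y => by
    have hd : ∀ y, HasDerivAt (fun y => ψ y * χ' y - ψ' y * χ y) 0 y := fun y =>
      (hψ.hasDerivAt_wronskian hχ y).congr_deriv (by ring)
    have := is_const_of_deriv_eq_zero (fun y => (hd y).differentiableAt)
      (fun y => (hd y).deriv) y R
    rw [this, hψR, hψR', hχR, hχR']; norm_num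
  -- Since the Wronskian is `1`, the ratio has derivative `-1 / χ²`. Its infimum `s` is never
  -- attained, so `ψ - s χ` is positive: it is the minimal solution.
  have hρ : StrictAntiOn (fun y => ψ y / χ y) (Ici R) := by
    have hd : ∀ y ∈ Ici R, HasDerivAt (fun y => ψ y / χ y) (-1 / χ y ^ 2) y := fun y hy => by
      refine ((hψ.deriv₁ y).div (hχ.deriv₁ y) (hχp y hy).1.ne').congr_deriv ?_
      congr 1
      linarith [hW y]
    refine strictAntiOn_of_deriv_neg (convex_Ici R)
      (fun y hy => (hd y hy).continuousAt.continuousWithinAt) fun y hy => ?_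
    have hy' := interior_subset hy
    rw [(hd y hy').deriv]
    exact div_neg_of_neg_of_pos (by norm_num) (pow_pos (hχp y hy').1 2)
  set s := sInf ((fun y => ψ y / χ y) '' Ici R) with hs
  have hbdd : BddBelow ((fun y => ψ y / χ y) '' Ici R) :=
    ⟨0, by rintro _ ⟨y, hy, rfl⟩; exact (div_pos (hψp y hy) (hχp y hy).1).le⟩
  have hslt : ∀ y, R ≤ y → s < ψ y / χ y := fun y hy => by
    have hy1 : R ≤ y + 1 := by linarith
    exact (csInf_le hbdd ⟨y + 1, hy1, rfl⟩).trans_lt (hρ hy hy1 (by linarith))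
  have hφ := hψ.sub (hχ.const_mul s)
  have hpos : ∀ y, R ≤ y → 0 < ψ y - s * χ y := fun y hy => by
    have := (lt_div_iff₀ (hχp y hy).1).1 (hslt y hy)
    linarith
  refine ⟨_, _, hφ, fun y₁ hy₁ => ⟨hpos y₁ hy₁, ?_⟩⟩
  -- If the slope were positive at `y₁`, then `ψ - s χ` would dominate `κ χ` from there on, so `ψ /
  -- χ` would stay above `s + κ`, contradicting the choice of `s`.
  by_contra! hlt
  have hp := hpos y₁ hy₁
  obtain ⟨hx, hx'⟩ := hχp y₁ hy₁
  set m := min (ψ y₁ - s * χ y₁) (ψ' y₁ - s * χ' y₁)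
  have hm : 0 < m := lt_min hp hlt
  set κ := m / (χ y₁ + χ' y₁ + 1)
  have hκ : 0 < κ := by positivity
  have hκm : κ * (χ y₁ + χ' y₁ + 1) = m := by simp only [κ]; field_simp
  have hcmp := hφ.sub (hχ.const_mul κ)
  have hm1 : m ≤ ψ y₁ - s * χ y₁ := min_le_left _ _
  have hm2 : m ≤ ψ' y₁ - s * χ' y₁ := min_le_right _ _
  have hge : ∀ y, y₁ ≤ y → s + κ ≤ ψ y / χ y := fun y hy => by
    have := (hcmp.pos_of_pos (a := y₁) (fun z hz => hq0 z (hy₁.trans hz)) (by nlinarith)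
      (by nlinarith) hy).1
    rw [le_div_iff₀ (hχp y (hy₁.trans hy)).1]
    linarith
  have : s + κ ≤ s := by
    refine le_csInf ⟨_, R, self_mem_Ici, rfl⟩ ?_
    rintro _ ⟨y, hy, rfl⟩
    rcases le_total y₁ y with h | h
    · exact hge y h
    · exact (hge y₁ le_rfl).trans (hρ.antitoneOn hy hy₁ h)
  linarith

/-- If `q ≥ c > 0` on `[R, ∞)`, there is a decaying solution. -/
theorem exists_isDecaying (hq : Continuous q) (hc : 0 < c) (hqc : ∀ y, R ≤ y → c ≤ q y)
    {α : ℝ} (hα : 0 < α) : ∃ f f', IsDecaying q R f f' ∧ f R = α := by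
  obtain ⟨φ, φ', hφ, hp⟩ := exists_pos_antitone hq fun y hy => hc.le.trans (hqc y hy)
  have h1 : IntegrableOn φ' (Ioi R) := by
    have := integrableOn_Ioi_deriv_of_nonneg_of_le (C := 0) (fun y => (hφ.deriv₁ y).neg)
      (fun y hy => by linarith [(hp y hy).2])
      (fun y hy => by simpa using (hp y hy).1.le)
    simpa using this.neg
  -- `q φ = φ''` is nonnegative and its primitive `φ'` is bounded above by `0`; dividing by `q ≥ c`
  -- then makes `φ` itself integrable.
  have h2 : IntegrableOn (fun y => q y * φ y) (Ioi R) :=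
    integrableOn_Ioi_deriv_of_nonneg_of_le (C := 0) hφ.deriv₂
      (fun y hy => mul_nonneg (hc.le.trans (hqc y hy)) (hp y hy).1.le) fun y hy => (hp y hy).2
  have h3 : IntegrableOn φ (Ioi R) := by
    refine Integrable.mono' (h2.const_mul c⁻¹) hφ.continuous.aestronglyMeasurable ?_
    filter_upwards [ae_restrict_mem measurableSet_Ioi] with y hy
    have hy' : R ≤ y := le_of_lt hy
    rw [Real.norm_of_nonneg (hp y hy').1.le, inv_mul_eq_div, le_div_iff₀ hc, mul_comm]
    exact mul_le_mul_of_nonneg_right (hqc y hy') (hp y hy').1.le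
  have hanti : ∀ y, R ≤ y → φ y ≤ φ R := fun y hy => by
    have := monotoneOn_Ici_of_hasDerivAt_nonneg (a := R) (fun y => (hφ.deriv₁ y).neg)
      (fun y hy => by linarith [(hp y hy).2]) self_mem_Ici hy hy
    simpa using this
  have hR := (hp R le_rfl).1
  have hk : 0 < α / φ R := by positivity
  refine ⟨_, _, ⟨hφ.const_mul (α / φ R), fun y hy => mul_pos hk (hp y hy).1,
    fun y hy => mul_le_mul_of_nonneg_left (hanti y hy) hk.le, h3.const_mul _, ?_, ?_⟩, ?_⟩
  · simpa using (tendsto_zero_of_hasDerivAt_of_integrableOn_Ioi (fun y _ => hφ.deriv₁ y)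
      h1 h3).const_mul (α / φ R)
  · simpa using (tendsto_zero_of_hasDerivAt_of_integrableOn_Ioi (fun y _ => hφ.deriv₂ y)
      h2 h1).const_mul (α / φ R)
  · field_simp

lemma integrableOn_sq (h : IsDecaying q R f f') : IntegrableOn (fun y => f y ^ 2) (Ioi R) := by
  refine Integrable.mono' (h.integrableOn.const_mul (f R))
    (h.continuous.pow 2).aestronglyMeasurable ?_
  filter_upwards [ae_restrict_mem measurableSet_Ioi] with y hy
  have hy' : R ≤ y := le_of_lt hy
  rw [Real.norm_of_nonneg (by positivity), sq]
  exact mul_le_mul_of_nonneg_right (h.le y hy') (h.pos y hy').le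

/-- A square integrable solution on `[R, ∞)` is a multiple of the decaying one. -/
theorem eq_const_mul (hq : Continuous q) (hq0 : ∀ y, R ≤ y → 0 ≤ q y)
    (hf : IsDecaying q R f f') (hg : IsSol q g g')
    (hi : IntegrableOn (fun y => g y ^ 2) (Ioi R)) (y : ℝ) : g y = g R / f R * f y := by
  set κ := g R / f R
  have hv := hg.sub (hf.const_mul κ)
  have hR := hf.pos R le_rfl
  have hvR : g R - κ * f R = 0 := by simp only [κ]; field_simp; ring
  -- The difference vanishes at `R`, so its square is nondecreasing from there; being integrable, it
  -- must be zero.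
  have hmono := hv.monotoneOn_sq hq0 (by simp [hvR])
  have hvi : IntegrableOn (fun y => (g y - κ * f y) * (g y - κ * f y)) (Ioi R) := by
    refine Integrable.mono' ((hi.const_mul 2).add (hf.integrableOn_sq.const_mul (2 * κ ^ 2)))
      (hv.continuous.mul hv.continuous).aestronglyMeasurable (Eventually.of_forall fun y => ?_)
    rw [Real.norm_of_nonneg (mul_self_nonneg _)]
    simp only [Pi.add_apply]
    nlinarith [sq_nonneg (g y + κ * f y)]
  have hz : ∀ y, R ≤ y → g y - κ * f y = 0 := fun y hy => by
    by_contra hne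
    exact not_integrableOn_Ioi_of_le (mul_self_pos.2 hne)
      (fun z hz => hmono hy (hy.trans hz) hz) hvi
  have hz' : g' (R + 1) - κ * f' (R + 1) = 0 := by
    refine (hv.deriv₁ (R + 1)).unique ((hasDerivAt_const (R + 1) (0 : ℝ)).congr_of_eventuallyEq ?_)
    filter_upwards [eventually_gt_nhds (show R < R + 1 by linarith)] with z hz1
    exact hz z hz1.le
  linarith [hv.eq_zero hq (hz (R + 1) (by linarith)) hz' y]

/-- By uniqueness up to scale, square integrability and one positive value suffice. Applied to the
Hermite function, this gives positivity on all of `[R, ∞)` at once. -/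
theorem of_integrableOn_sq (hq : Continuous q) (hc : 0 < c) (hqc : ∀ y, R ≤ y → c ≤ q y)
    (hg : IsSol q g g') (hi : IntegrableOn (fun y => g y ^ 2) (Ioi R)) (hR : 0 < g R) :
    IsDecaying q R g g' := by
  obtain ⟨f, f', hf, hfR⟩ := exists_isDecaying hq hc hqc hR
  have hgf : g = f := funext fun y => by
    rw [eq_const_mul hq (fun y hy => hc.le.trans (hqc y hy)) hf hg hi y, hfR, div_self hR.ne',
      one_mul]
  have hgf' : g' = f' := funext fun y => (hg.deriv₁ y).unique (hgf ▸ hf.deriv₁ y)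
  rwa [hgf, hgf']

/-- Comparison of the slopes of decaying solutions of two equations. -/
theorem abs_slope_sub_le (hq₁ : Continuous q₁) (hq₂ : Continuous q₂)
    (hf : IsDecaying q₁ R f f') (hg : IsDecaying q₂ R g g') (hR : f R = g R)
    (hi : IntegrableOn (fun y => |q₁ y - q₂ y| * g y) (Ioi R)) :
    |f' R - g' R| ≤ ∫ y in Ioi R, |q₁ y - q₂ y| * g y := by
  have hfR := hf.pos R le_rfl
  have hb : ∀ y ∈ Ioi R, ‖(q₂ y - q₁ y) * (f y * g y)‖ ≤ f R * (|q₁ y - q₂ y| * g y) :=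
    fun y hy => by
      have hy' : R ≤ y := le_of_lt hy
      have h1 := hf.pos y hy'
      have h2 := hg.pos y hy'
      have h3 := hf.le y hy'
      rw [norm_mul, norm_mul, Real.norm_of_nonneg h1.le, Real.norm_of_nonneg h2.le,
        Real.norm_eq_abs, abs_sub_comm]
      calc |q₁ y - q₂ y| * (f y * g y) = f y * (|q₁ y - q₂ y| * g y) := by ring
        _ ≤ _ := by gcongr
  have hint : IntegrableOn (fun y => (q₂ y - q₁ y) * (f y * g y)) (Ioi R) :=
    Integrable.mono' (hi.const_mul (f R))
      ((hq₂.sub hq₁).mul (hf.continuous.mul hg.continuous)).aestronglyMeasurable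
      ((ae_restrict_iff' measurableSet_Ioi).2 (Eventually.of_forall hb))
  have hlim : Tendsto (fun y => f y * g' y - f' y * g y) atTop (𝓝 0) := by
    simpa using (hf.tendsto.mul hg.tendsto').sub (hf.tendsto'.mul hg.tendsto)
  -- The Wronskian vanishes at infinity, so its value at `R`, namely `f R * (g' R - f' R)`, is minus
  -- the integral of `(q₂ - q₁) f g`. Bounding `f` by `f R` lets that factor cancel.
  have key := integral_Ioi_of_hasDerivAt_of_tendsto'
    (fun y _ => hf.hasDerivAt_wronskian hg.toIsSol y) hint hlim
  have h1 : |∫ y in Ioi R, (q₂ y - q₁ y) * (f y * g y)| ≤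
      f R * ∫ y in Ioi R, |q₁ y - q₂ y| * g y := by
    rw [← integral_const_mul]
    exact (norm_integral_le_integral_norm _).trans
      (setIntegral_mono_on hint.norm (hi.const_mul _) measurableSet_Ioi hb)
  have h2 : 0 - (f R * g' R - f' R * g R) = f R * (f' R - g' R) := by rw [← hR]; ring
  rw [key, h2, abs_mul, abs_of_pos hfR] at h1
  exact le_of_mul_le_mul_left h1 hfR

end IsDecaying

/-! ### Formal perturbation theory of the harmonic oscillator -/

open Polynomial in
/-- Monic Hermite polynomials for the weight `exp (-y²)`. -/
noncomputable def monicHermite : ℕ → ℝ[X]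
  | 0 => 1
  | m + 1 => X * monicHermite m - C (1 / 2) * derivative (monicHermite m)

section Formal

open Polynomial

/-- The equation at `m` yields the lowering relation `H_{m+1}' = (m+1) H_m`, which in turn yields
the equation at `m + 1`. -/
lemma monicHermite_ode (m : ℕ) :
    derivative (derivative (monicHermite m)) =
      2 * X * derivative (monicHermite m) - C (2 * (m : ℝ)) * monicHermite m := by
  induction m with
  | zero => simp [monicHermite]
  | succ m ih =>
    have hd : derivative (monicHermite (m + 1)) = C ((m : ℝ) + 1) * monicHermite m := by
      simp only [monicHermite, derivative_sub, derivative_mul, derivative_X, derivative_C, ih]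
      refine Polynomial.funext fun r => ?_
      simp
      ring
    rw [hd]
    simp only [derivative_mul, derivative_C, monicHermite]
    refine Polynomial.funext fun r => ?_
    simp
    ring

lemma monicHermite_monic (m : ℕ) : (monicHermite m).Monic ∧ (monicHermite m).natDegree = m := by
  induction m with
  | zero => simp [monicHermite]
  | succ m ih =>
    have h1 : (X * monicHermite m).Monic := monic_X.mul ih.1
    have h2 : (X * monicHermite m).natDegree = m + 1 := by
      rw [monic_X.natDegree_mul ih.1, natDegree_X, ih.2, add_comm]
    have h3 : (C (1 / 2) * derivative (monicHermite m)).degree < (X * monicHermite m).degree := by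
      rw [degree_eq_natDegree h1.ne_zero, h2]
      rw [degree_C_mul (by norm_num)]
      refine (degree_derivative_le).trans_lt ?_
      rw [degree_eq_natDegree ih.1.ne_zero, ih.2]
      exact_mod_cast Nat.lt_succ_self m
    refine ⟨h1.sub_of_left h3, ?_⟩
    rw [monicHermite, natDegree_eq_of_degree_eq (degree_sub_eq_left_of_degree_lt h3), h2]

/-- The harmonic oscillator `-∂² + y² - (2n+1)`, conjugated by the Gaussian `exp (-y²/2)`. -/
noncomputable def oscillator (n : ℕ) : ℝ[X] →ₗ[ℝ] ℝ[X] :=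
  -(derivative ∘ₗ derivative) + LinearMap.mulLeft ℝ (2 * X) ∘ₗ derivative
    - (2 * (n : ℝ)) • LinearMap.id

lemma oscillator_apply (n : ℕ) (q : ℝ[X]) : oscillator n q =
    -derivative (derivative q) + 2 * X * derivative q - C (2 * (n : ℝ)) * q := by
  simp [oscillator, smul_eq_C_mul, mul_assoc]

lemma oscillator_monicHermite (n : ℕ) : oscillator n (monicHermite n) = 0 := by
  rw [oscillator_apply, monicHermite_ode]; ring

/-- The operator is triangular on monomials and its diagonal vanishes only at `m = n`. The truncated
exponent `m - 2` does no harm, as its coefficient vanishes for `m ≤ 1`. -/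
lemma oscillator_X_pow (n m : ℕ) : oscillator n (X ^ m) =
    (2 * ((m : ℝ) - n)) • X ^ m - ((m : ℝ) * (m - 1)) • X ^ (m - 2) := by
  rw [oscillator_apply]
  refine Polynomial.funext fun r => ?_
  rcases m with _ | _ | m
  · simp
  · simp; ring
  · simp; ring

/-- For `m ≠ n` one divides by the diagonal entry; for `m = n` the Hermite polynomial replaces `X ^
n` up to lower degree. -/
lemma X_pow_mem_range_oscillator_sup (n m : ℕ) :
    (X ^ m : ℝ[X]) ∈ LinearMap.range (oscillator n) ⊔ ℝ ∙ monicHermite n := by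
  induction m using Nat.strong_induction_on with
  | _ m ih =>
    set S := LinearMap.range (oscillator n) ⊔ ℝ ∙ monicHermite n
    rcases eq_or_ne m n with rfl | hmn
    · obtain ⟨hmon, hdeg⟩ := monicHermite_monic m
      have hlt : (X ^ m - monicHermite m).degree < (m : WithBot ℕ) := by
        have := degree_sub_lt_left (p := (X ^ m : ℝ[X])) (q := monicHermite m)
          (by rw [degree_X_pow, degree_eq_natDegree hmon.ne_zero, hdeg]) (by simp)
          (by simp [hmon.leadingCoeff])
        rwa [degree_X_pow] at this
      have h1 : X ^ m - monicHermite m ∈ S := by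
        rw [as_sum_support_C_mul_X_pow (X ^ m - monicHermite m)]
        refine S.sum_mem fun i hi => ?_
        rw [← smul_eq_C_mul]
        exact S.smul_mem _ (ih i (by exact_mod_cast (le_degree_of_mem_supp i hi).trans_lt hlt))
      have h2 : monicHermite m ∈ S :=
        Submodule.mem_sup_right (Submodule.mem_span_singleton_self _)
      simpa using S.add_mem h1 h2
    · have hne : (2 * ((m : ℝ) - n)) ≠ 0 := by
        have : (m : ℝ) ≠ n := by exact_mod_cast hmn
        exact mul_ne_zero two_ne_zero (sub_ne_zero.2 this)
      have h1 : oscillator n (X ^ m) ∈ S := Submodule.mem_sup_left ⟨_, rfl⟩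
      have h2 : ((m : ℝ) * (m - 1)) • (X ^ (m - 2) : ℝ[X]) ∈ S := by
        rcases m with _ | _ | m
        · simp
        · simp
        · exact S.smul_mem _ (ih _ (by omega))
      have h3 := S.smul_mem (2 * ((m : ℝ) - n))⁻¹ (S.add_mem h1 h2)
      rwa [oscillator_X_pow, sub_add_cancel, smul_smul, inv_mul_cancel₀ hne, one_smul] at h3

/-- Solvability of each order of perturbation theory: the eigenvalue coefficient `s.1` absorbs the
obstruction along the Hermite polynomial. -/
lemma exists_oscillator_eq (n : ℕ) (f : ℝ[X]) :
    ∃ s : ℝ × ℝ[X], oscillator n s.2 = C s.1 * monicHermite n - f := by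
  have hf : f ∈ LinearMap.range (oscillator n) ⊔ ℝ ∙ monicHermite n := by
    rw [f.as_sum_range_C_mul_X_pow]
    refine Submodule.sum_mem _ fun i _ => ?_
    rw [← smul_eq_C_mul]
    exact Submodule.smul_mem _ _ (X_pow_mem_range_oscillator_sup n i)
  obtain ⟨_, ⟨q, rfl⟩, _, hc, rfl⟩ := Submodule.mem_sup.1 hf
  obtain ⟨c, rfl⟩ := Submodule.mem_span_singleton.1 hc
  exact ⟨(c, -q), by rw [map_neg, smul_eq_C_mul]; ring⟩

/-- The recursion of formal perturbation theory, with prescribed terms of order at most two: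
`S` solves the equation of order `j` and `W` is the sequence of Taylor coefficients of the
potential. -/
noncomputable def perturbationSeq (S : ℝ[X] → ℝ × ℝ[X]) (W : ℕ → ℝ[X])
    (s₀ s₁ s₂ : ℝ × ℝ[X]) : ℕ → ℝ × ℝ[X]
  | 0 => s₀
  | 1 => s₁
  | 2 => s₂
  | m + 3 => S (W (m + 3) * s₀.2 + ∑ i : Fin (m + 2),
      (W (i + 1) - C (perturbationSeq S W s₀ s₁ s₂ (i + 1)).1) *
        (perturbationSeq S W s₀ s₁ s₂ (m + 2 - i)).2)
termination_by m => m
decreasing_by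
  · have := i.2; omega
  · omega

/-- The differential operator `-∂² + 2 y ∂` on polynomials. -/
noncomputable def gaussOp (q : ℝ[X]) : ℝ[X] :=
  -derivative (derivative q) + 2 * X * derivative q

/-- Existence of formal perturbation series with given terms of order one and two. -/
theorem exists_perturbation_series (n : ℕ) (W : ℕ → ℝ[X]) (hW : W 0 = -C (2 * (n : ℝ)))
    (q₁ q₂ : ℝ[X]) (c : ℝ) (h₁ : oscillator n q₁ + W 1 * monicHermite n = 0)
    (h₂ : oscillator n q₂ + W 1 * q₁ + (W 2 - C c) * monicHermite n = 0) :
    ∃ (Λ : ℕ → ℝ) (q : ℕ → ℝ[X]), Λ 0 = 0 ∧ Λ 1 = 0 ∧ Λ 2 = c ∧ q 0 = monicHermite n ∧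
      ∀ j, gaussOp (q j) +
        ∑ il ∈ Finset.HasAntidiagonal.antidiagonal j, (W il.1 - C (Λ il.1)) * q il.2 = 0 := by
  choose S hS using exists_oscillator_eq n
  set s := perturbationSeq S W (0, monicHermite n) (0, q₁) (c, q₂) with hs
  have s0 : s 0 = (0, monicHermite n) := by rw [hs, perturbationSeq]
  have s1 : s 1 = (0, q₁) := by rw [hs, perturbationSeq]
  have s2 : s 2 = (c, q₂) := by rw [hs, perturbationSeq]
  have s3 : ∀ m, s (m + 3) = S (W (m + 3) * monicHermite n + ∑ i ∈ Finset.range (m + 2),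
      (W (i + 1) - C (s (i + 1)).1) * (s (m + 2 - i)).2) := fun m => by
    rw [Finset.sum_range (n := m + 2)
      (f := fun i => (W (i + 1) - C (s (i + 1)).1) * (s (m + 2 - i)).2), hs, perturbationSeq]
  -- The constant `2n` separating the two operators is cancelled by `W 0 = -2n`.
  have hg : ∀ f, gaussOp f = oscillator n f + C (2 * (n : ℝ)) * f := fun f => by
    rw [oscillator_apply, gaussOp]; ring
  refine ⟨fun j => (s j).1, fun j => (s j).2, by simp [s0], by simp [s1], by simp [s2],
    by simp [s0], fun j => ?_⟩
  rw [Finset.Nat.sum_antidiagonal_eq_sum_range_succ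
    (fun i l => (W i - C (s i).1) * (s l).2) j, hg]
  rcases j with _ | _ | _ | m
  · simp [s0, hW, oscillator_monicHermite]
  · simp [Finset.sum_range_succ, s0, s1, hW]
    linear_combination h₁
  · simp [Finset.sum_range_succ, s0, s1, s2, hW]
    linear_combination h₂
  -- The term `i = 0` completes `gaussOp` to `oscillator`, the term `i = j` carries the unknown `Λ
  -- j`, and the middle terms are already known.
  · rw [Finset.sum_range_succ, Finset.sum_range_succ']
    have hm := hS (W (m + 3) * monicHermite n + ∑ i ∈ Finset.range (m + 2),
      (W (i + 1) - C (s (i + 1)).1) * (s (m + 2 - i)).2)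
    rw [← s3] at hm
    have hsum : ∑ i ∈ Finset.range (m + 2),
        (W (i + 1) - C (s (i + 1)).1) * (s (m + 2 + 1 - (i + 1))).2 =
        ∑ i ∈ Finset.range (m + 2), (W (i + 1) - C (s (i + 1)).1) * (s (m + 2 - i)).2 :=
      Finset.sum_congr rfl fun i _ => by rw [Nat.add_sub_add_right]
    have e1 : m + 1 + 1 + 1 = m + 3 := rfl
    have e2 : m + 1 + 1 = m + 2 := rfl
    simp only [e1, e2, Nat.sub_self, Nat.sub_zero, s0, hW] at hm ⊢
    rw [hsum]
    simp only [C_0]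
    linear_combination hm

end Formal

/-! ### The potential -/

/-- The potential `p_ε² - (2n+1) p_ε'`. -/
noncomputable def potential (k n : ℕ) (ε y : ℝ) : ℝ :=
  pFun k ε y ^ 2 - (2 * (n : ℝ) + 1) * (1 + ε * y) ^ (k - 1)

section Potential

variable {k : ℕ}

lemma hasDerivAt_pFun (hk : 1 ≤ k) (ε y : ℝ) :
    HasDerivAt (pFun k ε) ((1 + ε * y) ^ (k - 1)) y := by
  have hk0 : (k : ℝ) ≠ 0 := by positivity
  by_cases hε : ε = 0
  · subst hε
    have : pFun k 0 = fun y => y := by ext y; simp [pFun]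
    rw [this]
    simpa using hasDerivAt_id' y
  · have : pFun k ε = fun y => (ε * k)⁻¹ * ((1 + ε * y) ^ k - 1) := by ext y; simp [pFun, hε]
    rw [this]
    have h1 : HasDerivAt (fun y => 1 + ε * y) ε y := by
      simpa using ((hasDerivAt_id y).const_mul ε).const_add 1
    refine (((h1.pow k).sub_const 1).const_mul (ε * k)⁻¹).congr_deriv ?_
    field_simp

lemma continuous_potential (hk : 1 ≤ k) (n : ℕ) (ε : ℝ) : Continuous (potential k n ε) := by
  have : Continuous (pFun k ε) :=
    continuous_iff_continuousAt.2 fun y => (hasDerivAt_pFun hk ε y).continuousAt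
  unfold potential
  fun_prop

/-- This symmetry turns solutions decaying at `+∞` for `-ε` into solutions decaying at `-∞` for `ε`.
-/
lemma potential_neg_neg (n : ℕ) (ε y : ℝ) :
    potential k n (-ε) (-y) = potential k n ε y := by
  have : pFun k (-ε) (-y) = -pFun k ε y := by
    by_cases hε : ε = 0
    · simp [pFun, hε]
    · simp [pFun, hε, inv_neg]
  simp [potential, this]

lemma potential_zero (n : ℕ) (y : ℝ) : potential k n 0 y = y ^ 2 - (2 * (n : ℝ) + 1) := by
  simp [potential, pFun]

open Polynomial in
/-- The potential as a polynomial in `ε` with coefficients polynomials in `y`. -/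
noncomputable def potentialPoly (k n : ℕ) : ℝ[X][X] :=
  (∑ i ∈ Finset.range k, C (C ((k.choose (i + 1) : ℝ) / k) * X ^ (i + 1)) * X ^ i) ^ 2
    - C (C (2 * (n : ℝ) + 1)) * (1 + C X * X) ^ (k - 1)

open Polynomial in
lemma evalEval_potentialPoly (hk : 1 ≤ k) (n : ℕ) (ε y : ℝ) :
    (potentialPoly k n).evalEval y ε = potential k n ε y := by
  have hk0 : (k : ℝ) ≠ 0 := by positivity
  have h1 : ∑ i ∈ Finset.range k, (k.choose (i + 1) : ℝ) / k * y ^ (i + 1) * ε ^ i =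
      pFun k ε y := by
    by_cases hε : ε = 0
    · subst hε
      obtain ⟨m, rfl⟩ := Nat.exists_eq_add_of_le' hk
      rw [Finset.sum_range_succ']
      simp only [pFun, if_true]
      rw [Finset.sum_eq_zero fun i _ => by simp]
      simp at hk0 ⊢
      field_simp
    · have h2 : (1 + ε * y) ^ k = ∑ i ∈ Finset.range k,
          (k.choose (i + 1) : ℝ) * (ε * y) ^ (i + 1) + 1 := by
        rw [add_comm, add_pow, Finset.sum_range_succ']
        simp [mul_comm]
      simp only [pFun, hε, if_false]
      rw [h2, add_sub_cancel_right, Finset.mul_sum]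
      refine Finset.sum_congr rfl fun i _ => ?_
      rw [mul_pow, pow_succ ε]
      field_simp
  have h3 : (∑ i ∈ Finset.range k, C (C ((k.choose (i + 1) : ℝ) / k) * X ^ (i + 1)) * X ^ i :
      ℝ[X][X]).evalEval y ε = pFun k ε y := by
    rw [evalEval_finsetSum, ← h1]
    refine Finset.sum_congr rfl fun i _ => ?_
    simp [evalEval]
  rw [potentialPoly, evalEval_sub, evalEval_pow, h3, potential]
  simp [evalEval]

open Polynomial in
lemma coeff_potentialPoly_sum (k i : ℕ) :
    (∑ i ∈ Finset.range k, C (C ((k.choose (i + 1) : ℝ) / k) * X ^ (i + 1)) * X ^ i :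
      ℝ[X][X]).coeff i = C ((k.choose (i + 1) : ℝ) / k) * X ^ (i + 1) := by
  rw [finsetSum_coeff]
  simp only [coeff_C_mul_X_pow]
  rw [Finset.sum_ite_eq]
  split_ifs with h
  · rfl
  · rw [Nat.choose_eq_zero_of_lt (by simp at h; omega)]
    simp

open Polynomial in
lemma coeff_one_add_C_X_mul_X_pow (m i : ℕ) :
    ((1 + C X * X) ^ m : ℝ[X][X]).coeff i = (m.choose i : ℝ[X]) * X ^ i := by
  have : ((1 + C X * X) ^ m : ℝ[X][X]) = ((1 + X) ^ m : ℝ[X][X]).comp (C X * X) := by simp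
  rw [this, comp_C_mul_X_coeff, coeff_one_add_X_pow]

lemma cast_choose_three (m : ℕ) :
    ((m + 1).choose 3 : ℝ) = (m + 1) * m * (m - 1) / 6 := by
  induction m with
  | zero => simp [Nat.choose]
  | succ m ih =>
    rw [Nat.choose_succ_succ' (m + 1) 2, Nat.cast_add, ih, Nat.cast_choose_two]
    push_cast
    ring

open Polynomial in
lemma potentialPoly_coeffs (m n : ℕ) :
    (potentialPoly (m + 1) n).coeff 0 = X ^ 2 - C (2 * (n : ℝ) + 1) ∧
    (potentialPoly (m + 1) n).coeff 1 = C (m : ℝ) * (X ^ 3 - C (2 * (n : ℝ) + 1) * X) ∧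
    (potentialPoly (m + 1) n).coeff 2 =
      C ((m : ℝ) ^ 2 / 4 + m * (m - 1) / 3) * X ^ 4
        - C ((2 * (n : ℝ) + 1) * (m * (m - 1) / 2)) * X ^ 2 := by
  have hm : (m : ℝ) + 1 ≠ 0 := by positivity
  have e1 : ((m + 1).choose 1 : ℝ) / ((m + 1 : ℕ) : ℝ) = 1 := by
    rw [Nat.choose_one_right]; push_cast; field_simp
  have e2 : ((m + 1).choose 2 : ℝ) / ((m + 1 : ℕ) : ℝ) = m / 2 := by
    rw [Nat.cast_choose_two]; push_cast; field_simp; ring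
  have e3 : ((m + 1).choose 3 : ℝ) / ((m + 1 : ℕ) : ℝ) = m * (m - 1) / 6 := by
    rw [cast_choose_three]; push_cast; field_simp
  have a0 := coeff_potentialPoly_sum (m + 1) 0
  have a1 := coeff_potentialPoly_sum (m + 1) 1
  have a2 := coeff_potentialPoly_sum (m + 1) 2
  rw [show 0 + 1 = 1 from rfl, e1] at a0
  rw [show 1 + 1 = 2 from rfl, e2] at a1
  rw [show 2 + 1 = 3 from rfl, e3] at a2
  refine ⟨?_, ?_, ?_⟩
  · rw [potentialPoly, coeff_sub, sq, mul_coeff_zero, coeff_C_mul, coeff_one_add_C_X_mul_X_pow, a0]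
    refine Polynomial.funext fun r => ?_
    simp; ring
  · rw [potentialPoly, coeff_sub, sq, coeff_mul, coeff_C_mul, coeff_one_add_C_X_mul_X_pow,
      show Finset.HasAntidiagonal.antidiagonal 1 = {(0, 1), (1, 0)} from rfl,
      Finset.sum_insert (by decide), Finset.sum_singleton, a0, a1]
    refine Polynomial.funext fun r => ?_
    simp; ring
  · rw [potentialPoly, coeff_sub, sq, coeff_mul, coeff_C_mul, coeff_one_add_C_X_mul_X_pow,
      show Finset.HasAntidiagonal.antidiagonal 2 = {(0, 2), (1, 1), (2, 0)} from rfl,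
      Finset.sum_insert (by decide), Finset.sum_insert (by decide), Finset.sum_singleton,
      a0, a1, a2]
    refine Polynomial.funext fun r => ?_
    simp [Nat.cast_choose_two]; ring

/-- The potential is bounded below by `1/2` away from a fixed bounded interval. -/
theorem exists_potential_lower_bound (hk : 1 ≤ k) (n : ℕ) :
    ∃ R₀ > 0, ∃ ε₀ > 0, ∀ ε y : ℝ, |ε| < ε₀ → R₀ ≤ |y| → 1 / 2 ≤ potential k n ε y := by
  have hk0 : (0 : ℝ) < k := by positivity
  set A : ℝ := 2 * (n : ℝ) + 1 with hA
  have hA1 : 1 ≤ A := by simp [hA]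
  set B : ℝ := A * 2 ^ (k - 1) + 1 with hB
  have h2k : (1 : ℝ) ≤ 2 ^ (k - 1) := one_le_pow₀ (by norm_num)
  have hB2 : A + 1 ≤ B := by rw [hB]; nlinarith
  -- Used when `|p_ε|` dominates: `P` stands for `|p_ε|` and `Y` for `A s^(k-1)`.
  have aux : ∀ P Z Y : ℝ, Y ≤ Z → 1 ≤ Z → 2 * Z ≤ P → 1 / 2 ≤ P ^ 2 - Y := fun P Z Y h1 h2 h3 => by
    nlinarith
  refine ⟨k * B, by positivity, 1 / (2 * k * B), by positivity, fun ε y hε hy => ?_⟩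
  by_cases hε0 : ε = 0
  · subst hε0
    rw [potential_zero]
    have hk1 : (1 : ℝ) ≤ k := by exact_mod_cast hk
    have : B ≤ |y| := by nlinarith
    have : B ^ 2 ≤ y ^ 2 := by rw [← sq_abs y]; gcongr
    nlinarith
  have hεp : 0 < |ε| := abs_pos.2 hε0
  have hD : 2 * B ≤ 1 / (|ε| * k) := by
    rw [le_div_iff₀ (by positivity)]
    rw [lt_div_iff₀ (by positivity)] at hε
    nlinarith
  set s := 1 + ε * y with hs
  have hp : |pFun k ε y| = 1 / (|ε| * k) * |s ^ k - 1| := by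
    simp only [pFun, hε0, if_false, ← hs]
    rw [abs_mul, abs_inv, abs_mul, abs_of_pos hk0, one_div]
  have hpot : potential k n ε y = |pFun k ε y| ^ 2 - A * s ^ (k - 1) := by
    rw [potential, sq_abs]
  rw [hpot]
  rcases le_or_gt 0 s with hs0 | hs0
  -- For `0 ≤ s ≤ 2` the factor `s^k - 1 = (s - 1) ∑ s^i` gives `|p_ε| ≥ |y| / k ≥ B`. For `s > 2`
  -- the bound `s^k - 1 ≥ s^(k-1)` and the large prefactor `1 / (|ε| k) ≥ 2B` win.
  · rcases le_or_gt s 2 with hs2 | hs2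
    · have hgeom : s ^ k - 1 = (∑ i ∈ Finset.range k, s ^ i) * (ε * y) := by
        rw [← mul_geom_sum, hs]; ring
      have hg1 : 1 ≤ ∑ i ∈ Finset.range k, s ^ i := by
        obtain ⟨m, rfl⟩ := Nat.exists_eq_add_of_le' hk
        rw [Finset.sum_range_succ']
        have : 0 ≤ ∑ i ∈ Finset.range m, s ^ (i + 1) := Finset.sum_nonneg fun i _ => by positivity
        simpa using this
      have h1 : B ≤ |pFun k ε y| := by
        rw [hp, hgeom, abs_mul, abs_mul, abs_of_nonneg (zero_le_one.trans hg1)]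
        have : 1 / (|ε| * k) * ((∑ i ∈ Finset.range k, s ^ i) * (|ε| * |y|)) =
            (∑ i ∈ Finset.range k, s ^ i) * (|y| / k) := by field_simp
        rw [this]
        have h3 : B ≤ |y| / k := by rw [le_div_iff₀ hk0]; linarith
        nlinarith
      have h2 : s ^ (k - 1) ≤ 2 ^ (k - 1) := by gcongr
      have h3 : A * s ^ (k - 1) ≤ B - 1 := by rw [hB]; nlinarith
      nlinarith
    · have hpow : s ^ k = s ^ (k - 1) * s := by
        rw [← pow_succ, Nat.sub_add_cancel hk]
      have h1 : 1 ≤ s ^ (k - 1) := one_le_pow₀ (by linarith)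
      have h2 : s ^ (k - 1) ≤ |s ^ k - 1| := by
        refine le_trans ?_ (le_abs_self _)
        rw [hpow]; nlinarith
      have h3 : 2 * B * s ^ (k - 1) ≤ |pFun k ε y| := by
        rw [hp]; exact mul_le_mul hD h2 (by positivity) (by positivity)
      exact aux _ (B * s ^ (k - 1)) _ (by gcongr; linarith) (by nlinarith) (by linarith)
  · obtain ⟨t, ht⟩ : ∃ t, t = -s := ⟨_, rfl⟩
    have ht0 : 0 < t := by simpa [ht] using hs0
    have hst : s = -t := by simp [ht]
    -- For `s < 0` and even `k`, the term `-A s^(k-1)` is positive: either it suffices alone, or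
    -- `|s|` is so small that `p_ε` is large. For odd `k`, `|s^k - 1| = 1 + t^k` controls `t^(k-1)`.
    rcases Nat.even_or_odd k with hev | hodd
    · have hodd' : Odd (k - 1) := Nat.Even.sub_odd hk hev odd_one
      rw [hst, hodd'.neg_pow]
      rcases le_or_gt (1 / 2) (t ^ (k - 1)) with h | h
      · nlinarith [sq_nonneg |pFun k ε y|]
      · have ht1 : t < 1 := by
          by_contra! h1
          linarith [one_le_pow₀ (n := k - 1) h1]
        have hpow : t ^ k = t ^ (k - 1) * t := by
          rw [← pow_succ, Nat.sub_add_cancel hk]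
        have htk : t ^ k ≤ 1 / 2 := by
          rw [hpow]; nlinarith [pow_pos ht0 (k - 1)]
        have h2 : 1 / 2 ≤ |s ^ k - 1| := by
          rw [hst, hev.neg_pow, abs_sub_comm]
          refine le_trans ?_ (le_abs_self _)
          linarith
        have h3 : 2 * B * (1 / 2) ≤ |pFun k ε y| := by
          rw [hp]; exact mul_le_mul hD h2 (by positivity) (by positivity)
        nlinarith [pow_pos ht0 (k - 1)]
    · have hev' : Even (k - 1) := Nat.Odd.sub_odd hodd odd_one
      rw [hst, hev'.neg_pow]
      have hpow : t ^ k = t ^ (k - 1) * t := by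
        rw [← pow_succ, Nat.sub_add_cancel hk]
      have h2 : 1 + t ^ k ≤ |s ^ k - 1| := by
        rw [hst, hodd.neg_pow, abs_sub_comm]
        refine le_trans ?_ (le_abs_self _)
        linarith
      have htk0 := pow_pos ht0 k
      have htp : t ^ (k - 1) ≤ 1 + t ^ k := by
        rcases le_or_gt t 1 with h | h
        · linarith [pow_le_one₀ (n := k - 1) ht0.le h]
        · rw [hpow]; nlinarith [pow_pos ht0 (k - 1)]
      have h3 : 2 * B * (1 + t ^ k) ≤ |pFun k ε y| := by
        rw [hp]; exact mul_le_mul hD h2 (by positivity) (by positivity)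
      have h4 : A * t ^ (k - 1) ≤ B * (1 + t ^ k) :=
        mul_le_mul (by linarith) htp (by positivity) (by positivity)
      exact aux _ _ _ h4 (by nlinarith) (by linarith)

end Potential

/-! ### Quasimodes -/

section Gauss

open Polynomial

/-- A polynomial times the Gaussian `exp (-y²/2)`. -/
noncomputable def polyGauss (P : ℝ[X]) (y : ℝ) : ℝ := P.eval y * Real.exp (-(1 / 2) * y ^ 2)

lemma hasDerivAt_polyGauss (P : ℝ[X]) (y : ℝ) :
    HasDerivAt (polyGauss P) (polyGauss (derivative P - X * P) y) y := by
  have h1 : HasDerivAt (fun y : ℝ => -(1 / 2) * y ^ 2) (-y) y :=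
    ((hasDerivAt_pow 2 y).const_mul (-(1 / 2) : ℝ)).congr_deriv (by norm_num; ring)
  refine ((P.hasDerivAt y).mul h1.exp).congr_deriv ?_
  simp only [polyGauss, eval_sub, eval_mul, eval_X]
  ring

lemma continuous_polyGauss (P : ℝ[X]) : Continuous (polyGauss P) :=
  continuous_iff_continuousAt.2 fun y => (hasDerivAt_polyGauss P y).continuousAt

lemma integrable_polyGauss (P : ℝ[X]) : Integrable (polyGauss P) := by
  induction P using Polynomial.induction_on' with
  | add p q hp hq =>
    refine (hp.add hq).congr (Eventually.of_forall fun y => ?_)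
    simp [polyGauss, add_mul]
  | monomial m a =>
    have := (integrable_rpow_mul_exp_neg_mul_sq (b := 1 / 2) (by norm_num) (s := m)
      (lt_of_lt_of_le (by norm_num) (Nat.cast_nonneg m))).const_mul a
    refine this.congr (Eventually.of_forall fun y => ?_)
    simp [polyGauss, mul_assoc]

lemma tendsto_polyGauss_atTop (P : ℝ[X]) : Tendsto (polyGauss P) atTop (𝓝 0) :=
  tendsto_zero_of_hasDerivAt_of_integrableOn_Ioi (a := 0) (fun y _ => hasDerivAt_polyGauss P y)
    (integrable_polyGauss _).integrableOn (integrable_polyGauss _).integrableOn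

lemma tendsto_polyGauss_atBot (P : ℝ[X]) : Tendsto (polyGauss P) atBot (𝓝 0) :=
  tendsto_zero_of_hasDerivAt_of_integrableOn_Iic (a := 0) (fun y _ => hasDerivAt_polyGauss P y)
    (integrable_polyGauss _).integrableOn (integrable_polyGauss _).integrableOn

/-- Uniform Gaussian domination of a polynomial in two variables. -/
lemma exists_integrable_bound (T : ℝ[X][X]) : ∃ G : ℝ → ℝ, Integrable G ∧
    ∀ ε y : ℝ, |ε| ≤ 1 → |polyGauss (T.eval (C ε)) y| ≤ G y := by
  refine ⟨fun y => ∑ i ∈ Finset.range (T.natDegree + 1), |polyGauss (T.coeff i) y|,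
    integrable_finsetSum _ fun i _ => (integrable_polyGauss _).norm, fun ε y hε => ?_⟩
  have : polyGauss (T.eval (C ε)) y =
      ∑ i ∈ Finset.range (T.natDegree + 1), polyGauss (T.coeff i) y * ε ^ i := by
    rw [polyGauss, eval_eq_sum_range (p := T), eval_finsetSum, Finset.sum_mul]
    refine Finset.sum_congr rfl fun i _ => ?_
    simp [polyGauss]
    ring
  rw [this]
  refine (Finset.abs_sum_le_sum_abs _ _).trans (Finset.sum_le_sum fun i _ => ?_)
  rw [abs_mul, abs_pow]
  exact mul_le_of_le_one_right (abs_nonneg _) (pow_le_one₀ (abs_nonneg _) hε)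

lemma polyGauss_C_mul (c : ℝ) (P : ℝ[X]) (y : ℝ) :
    polyGauss (C c * P) y = c * polyGauss P y := by
  simp [polyGauss, mul_assoc]

lemma polyGauss_sub (P Q : ℝ[X]) (y : ℝ) :
    polyGauss (P - Q) y = polyGauss P y - polyGauss Q y := by
  simp [polyGauss, sub_mul]

/-- The eigenfunction of the harmonic oscillator. -/
noncomputable def hermiteFun (n : ℕ) : ℝ → ℝ := polyGauss (monicHermite n)

/-- The derivative of `hermiteFun`. -/
noncomputable def hermiteFun' (n : ℕ) : ℝ → ℝ :=
  polyGauss (derivative (monicHermite n) - X * monicHermite n)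

/-- Conjugation by the Gaussian turns `-∂² + y² - 1` into `gaussOp`, so perturbation theory can run
on polynomials alone. -/
lemma hasDerivAt_polyGauss_deriv (P : ℝ[X]) (y : ℝ) :
    HasDerivAt (polyGauss (derivative P - X * P))
      ((y ^ 2 - 1) * polyGauss P y - polyGauss (gaussOp P) y) y := by
  refine (hasDerivAt_polyGauss _ y).congr_deriv ?_
  simp [polyGauss, gaussOp]
  ring

lemma isSol_hermiteFun (k n : ℕ) : IsSol (potential k n 0) (hermiteFun n) (hermiteFun' n) := by
  refine ⟨fun y => hasDerivAt_polyGauss _ y, fun y => ?_⟩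
  refine (hasDerivAt_polyGauss_deriv _ y).congr_deriv ?_
  rw [gaussOp, monicHermite_ode, potential_zero]
  simp [polyGauss, hermiteFun]
  ring

/-- First two orders of perturbation theory. -/
lemma exists_second_order (m n : ℕ) : ∃ q₁ q₂ : ℝ[X],
    oscillator n q₁ + (potentialPoly (m + 1) n).coeff 1 * monicHermite n = 0 ∧
    oscillator n q₂ + (potentialPoly (m + 1) n).coeff 1 * q₁ +
      ((potentialPoly (m + 1) n).coeff 2 - C ((m : ℝ) * n * (n + 1) / 2)) * monicHermite n = 0 := by
  obtain ⟨-, h1, h2⟩ := potentialPoly_coeffs m n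
  have hode := monicHermite_ode n
  set H := monicHermite n
  set H' := derivative H with hH'
  -- The Hermite equation eliminates `H''`, so the combinations `a H + b H'` with polynomial `a`,
  -- `b` are stable under the operator. The correctors are sought in this form, uniformly in `n`.
  have hL : ∀ a b : ℝ[X], oscillator n (a * H + b * H') =
      (-derivative (derivative a) + 2 * X * derivative a + C (4 * (n : ℝ)) * derivative b) * H +
      (-2 * derivative a - derivative (derivative b) - 2 * X * derivative b - 2 * b) * H' := by
    intro a b
    rw [oscillator_apply]
    simp only [derivative_add, derivative_mul, ← hH', hode, derivative_sub, derivative_C,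
      derivative_X, derivative_ofNat]
    refine Polynomial.funext fun r => ?_
    simp
    ring
  set N : ℝ := (n : ℝ)
  set K : ℝ := (m : ℝ)
  set v4 : ℝ := K ^ 2 / 4 + K * (K - 1) / 3
  set v2 : ℝ := (2 * N + 1) * (K * (K - 1) / 2)
  -- Matching the coefficients of `X⁴ H`, `X³ H'`, `X² H`, `X H'` gives these four constants in
  -- turn. The constant coefficient of `H` is then `-2 a2 + 4 N b1 - Λ₂`, which fixes `Λ₂`.
  set a4 : ℝ := (5 * K ^ 2 / 12 - K ^ 2 * (4 * N + 1) / 6 - v4) / 8 with ha4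
  set b3 : ℝ := -K ^ 2 * (2 * N + 1) / 24 - a4 with hb3
  set a2 : ℝ := (K ^ 2 * N * (2 * N + 1) / 3 + v2 + 12 * a4 - 12 * N * b3) / 4 with ha2
  set b1 : ℝ := K ^ 2 * (2 * N + 1) ^ 2 / 24 - a2 - 3 / 2 * b3 with hb1
  refine ⟨(C (-K / 6) * X ^ 3 + C (N * K / 3) * X) * H +
      (C (K / 6) * X ^ 2 - C (K * (2 * N + 1) / 6)) * H',
    (C (K ^ 2 / 72) * X ^ 6 + C a4 * X ^ 4 + C a2 * X ^ 2) * H +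
      (C b3 * X ^ 3 + C b1 * X) * H', ?_, ?_⟩
  · rw [hL, h1]
    refine Polynomial.funext fun r => ?_
    simp
    ring
  · rw [hL, h1, h2]
    refine Polynomial.funext fun r => ?_
    simp
    simp only [hb1, ha2, hb3, ha4, v4, v2]
    ring

/-- Quasimodes of every order. -/
theorem exists_quasimodes {k : ℕ} (hk : 1 ≤ k) (n : ℕ) : ∃ Λ : ℕ → ℝ,
    Λ 0 = 0 ∧ Λ 1 = 0 ∧ Λ 2 = ((k : ℝ) - 1) * n * (n + 1) / 2 ∧
    ∀ N, 1 ≤ N → ∃ (G : ℝ → ℝ) (P r : ℝ → ℝ[X]), Integrable G ∧ (∀ y, 0 ≤ G y) ∧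
      ∀ ε : ℝ, |ε| ≤ 1 →
      (∀ y, HasDerivAt (polyGauss (derivative (P ε) - X * P ε))
        ((potential k n ε y - ∑ j ∈ Finset.range N, Λ j * ε ^ j) * polyGauss (P ε) y
          - polyGauss (r ε) y) y) ∧
      (∀ y, |polyGauss (P ε) y - hermiteFun n y| ≤ |ε| * G y) ∧
      (∀ y, |polyGauss (r ε) y| ≤ |ε| ^ N * G y) := by
  obtain ⟨m, rfl⟩ := Nat.exists_eq_add_of_le' hk
  obtain ⟨q₁, q₂, h₁, h₂⟩ := exists_second_order m n
  obtain ⟨c0, -, -⟩ := potentialPoly_coeffs m n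
  -- Adding `1 - y²` removes the part of the potential already accounted for by the Gaussian.
  set V : ℝ[X][X] := potentialPoly (m + 1) n + C (1 - X ^ 2) with hV
  have hVs : ∀ i, V.coeff (i + 1) = (potentialPoly (m + 1) n).coeff (i + 1) := fun i => by
    rw [hV, coeff_add, coeff_C_succ, add_zero]
  have hV0 : V.coeff 0 = -C (2 * (n : ℝ)) := by
    rw [hV, coeff_add, coeff_C_zero, c0]
    refine Polynomial.funext fun r => ?_
    simp
  obtain ⟨Λ, q, hΛ0, hΛ1, hΛ2, hq0, hq⟩ := exists_perturbation_series n (fun i => V.coeff i) hV0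
    q₁ q₂ ((m : ℝ) * n * (n + 1) / 2) (by simpa only [hVs 0] using h₁)
    (by simpa only [hVs 0, hVs 1] using h₂)
  refine ⟨Λ, hΛ0, hΛ1, by rw [hΛ2]; push_cast; ring, fun N hN => ?_⟩
  set U : ℝ[X][X] := ∑ j ∈ Finset.range N, C (q j) * X ^ j with hU
  set M : ℝ[X][X] := ∑ j ∈ Finset.range N, C (C (Λ j)) * X ^ j with hM
  set D : ℝ[X][X] := ∑ j ∈ Finset.range N, C (gaussOp (q j)) * X ^ j with hD
  have hcoeff : ∀ (a : ℕ → ℝ[X]) (i : ℕ), i < N →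
      (∑ j ∈ Finset.range N, C (a j) * X ^ j : ℝ[X][X]).coeff i = a i := fun a i hi => by
    rw [finsetSum_coeff]
    simp only [coeff_C_mul_X_pow]
    rw [Finset.sum_ite_eq, if_pos (Finset.mem_range.2 hi)]
  -- The recursion says that all coefficients of the residual below order `N` in `ε` vanish; `T` is
  -- the remaining quotient, dominated uniformly for `|ε| ≤ 1`.
  obtain ⟨T, hT⟩ : X ^ N ∣ D + (V - M) * U := by
    rw [X_pow_dvd_iff]
    intro d hd
    rw [coeff_add, hD, hcoeff _ d hd, coeff_mul, ← hq d]
    congr 1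
    refine Finset.sum_congr rfl fun il hil => ?_
    have := Finset.HasAntidiagonal.mem_antidiagonal.1 hil
    rw [coeff_sub, hM, hU, hcoeff _ il.1 (by omega), hcoeff _ il.2 (by omega)]
  obtain ⟨T₁, hT₁⟩ : X ∣ U - C (monicHermite n) := by
    rw [X_dvd_iff, coeff_sub, hU, hcoeff _ 0 (by omega), hq0, coeff_C_zero, sub_self]
  obtain ⟨G, hGi, hG⟩ := exists_integrable_bound T
  obtain ⟨G₁, hGi₁, hG₁⟩ := exists_integrable_bound T₁
  refine ⟨fun y => |G y| + |G₁ y|, fun ε => U.eval (C ε), fun ε => C (ε ^ N) * T.eval (C ε),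
    hGi.norm.add hGi₁.norm, fun y => by positivity, fun ε hε => ⟨fun y => ?_, fun y => ?_, fun y => ?_⟩⟩
  · refine (hasDerivAt_polyGauss_deriv _ y).congr_deriv ?_
    have hDU : gaussOp (U.eval (C ε)) = D.eval (C ε) := by
      have hlin : ∀ (c : ℝ) (p : ℝ[X]), gaussOp (p * C c) = gaussOp p * C c := fun c p => by
        simp only [gaussOp, derivative_mul, derivative_C, mul_zero, add_zero]; ring
      simp only [hU, hD, eval_finsetSum, eval_mul, eval_C, eval_pow, eval_X, ← C_pow, ← hlin]
      simp only [gaussOp, derivative_sum, Finset.sum_add_distrib, Finset.sum_neg_distrib,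
        Finset.mul_sum]
    have h1 := congrArg (fun S => polyGauss (S.eval (C ε)) y) hT
    have hpot := evalEval_potentialPoly hk n ε y
    have hMe : (M.eval (C ε)).eval y = ∑ j ∈ Finset.range N, Λ j * ε ^ j := by
      simp [hM, eval_finsetSum]
    rw [evalEval] at hpot
    rw [hDU]
    simp only [polyGauss, hV, eval_add, eval_mul, eval_sub, eval_C, eval_one, eval_pow, eval_X,
      hpot, hMe] at h1 ⊢
    linear_combination -h1
  · have h1 := congrArg (fun S => polyGauss (S.eval (C ε)) y) hT₁
    simp only [eval_sub, eval_C, eval_mul, eval_X, polyGauss_sub, polyGauss_C_mul] at h1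
    rw [hermiteFun, h1, abs_mul]
    gcongr
    exact ((hG₁ ε y hε).trans (le_abs_self _)).trans (le_add_of_nonneg_left (abs_nonneg _))
  · rw [polyGauss_C_mul, abs_mul, abs_pow]
    gcongr
    exact ((hG ε y hε).trans (le_abs_self _)).trans (le_add_of_nonneg_right (abs_nonneg _))

/-- The potential is a perturbation of the oscillator of relative size `O(ε)`. -/
theorem exists_potential_sub_bound {k : ℕ} (hk : 1 ≤ k) (n : ℕ) : ∃ T : ℝ[X][X],
    ∀ ε y : ℝ, potential k n ε y - potential k n 0 y = ε * T.evalEval y ε := by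
  obtain ⟨T, hT⟩ : X ∣ potentialPoly k n - C ((potentialPoly k n).coeff 0) := by
    rw [X_dvd_iff, coeff_sub, coeff_C_zero, sub_self]
  refine ⟨T, fun ε y => ?_⟩
  have h0 : potential k n 0 y = ((potentialPoly k n).coeff 0).eval y := by
    rw [← evalEval_potentialPoly hk, coeff_zero_eq_eval_zero, evalEval, C_0]
  rw [h0, ← evalEval_potentialPoly hk]
  have := congrArg (fun S => S.evalEval y ε) hT
  simpa [evalEval] using this

end Gauss

/-! ### Families of decaying solutions -/

/-- The slopes at `R` are compared by the Wronskian on `(R, ∞)`; after a reflection, Gronwall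
carries the estimate from `R` back to `-R`. -/
theorem IsDecaying.abs_sub_le {q₁ q₂ f f' g g' : ℝ → ℝ} {R M η : ℝ} (hq₁ : Continuous q₁)
    (hq₂ : Continuous q₂) (hf : IsDecaying q₁ R f f') (hg : IsDecaying q₂ R g g')
    (hR : f R = g R) (hi : IntegrableOn (fun y => |q₁ y - q₂ y| * g y) (Ioi R))
    (hM : ∀ y ∈ Icc (-R) R, |q₁ y| ≤ M) (hη : ∀ y ∈ Icc (-R) R, |q₁ y - q₂ y| * |g y| ≤ η)
    (hη0 : 0 ≤ η) (hint : ∫ y in Ioi R, |q₁ y - q₂ y| * g y ≤ η) {y : ℝ} (hy : y ∈ Icc (-R) R) :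
    |f y - g y| ≤ 2 * η * Real.exp ((M + 1) * (2 * R)) ∧
      |f' y - g' y| ≤ 2 * η * Real.exp ((M + 1) * (2 * R)) := by
  have hneg : ∀ y ∈ Icc (-R) R, -y ∈ Icc (-R) R := fun y hy =>
    ⟨by linarith [hy.2], by linarith [hy.1]⟩
  have hs := (abs_slope_sub_le hq₁ hq₂ hf hg hR hi).trans hint
  have key := hf.comp_neg.gronwall hg.comp_neg (a := -R) (b := R) (M := M) (η := η) (δ := η)
    (fun y hy => hM _ (hneg y hy)) (fun y hy => hη _ (hneg y hy)) (by simpa [hR] using hη0)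
    (by rw [neg_neg, neg_sub_neg, abs_sub_comm]; exact hs) (hneg y hy)
  simp only [neg_neg, neg_sub_neg] at key
  rw [show R - -R = 2 * R by ring, ← two_mul] at key
  exact ⟨key.1, by rw [abs_sub_comm]; exact key.2⟩

lemma continuousOn_of_pointwise_lipschitz {φ : ℝ → ℝ} {s : Set ℝ}
    (h : ∀ x ∈ s, ∃ K, ∀ y ∈ s, |φ y - φ x| ≤ K * |y - x|) : ContinuousOn φ s := by
  intro x hx
  obtain ⟨K, hK⟩ := h x hx
  rw [ContinuousWithinAt, tendsto_iff_norm_sub_tendsto_zero]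
  have hlim : Tendsto (fun y => K * |y - x|) (𝓝[s] x) (𝓝 0) := by
    have : Continuous fun y => K * |y - x| := by fun_prop
    simpa using (this.tendsto x).mono_left nhdsWithin_le_nhds
  refine squeeze_zero' (Eventually.of_forall fun y => norm_nonneg _) ?_ hlim
  filter_upwards [self_mem_nhdsWithin] with y hy using hK y hy

/-! ### Parity, positivity and integrability of the Hermite functions -/

section Hermite

open Polynomial

lemma monicHermite_comp_neg (m : ℕ) :
    (monicHermite m).comp (-X) = (-1) ^ m * monicHermite m := by
  induction m with
  | zero => simp [monicHermite]
  | succ m ih =>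
    have hd := congrArg derivative ih
    rw [derivative_comp] at hd
    have hd' : (derivative (monicHermite m)).comp (-X) =
        -((-1) ^ m * derivative (monicHermite m)) := by
      have h1 : derivative ((-1 : ℝ[X]) ^ m) = 0 := by
        rw [show (-1 : ℝ[X]) = C (-1) by simp, ← C_pow, derivative_C]
      rw [derivative_mul, h1, derivative_neg, derivative_X] at hd
      linear_combination -hd
    simp only [monicHermite, sub_comp, mul_comp, X_comp, C_comp, ih, hd']
    ring

lemma hermiteFun_neg (n : ℕ) (y : ℝ) : hermiteFun n (-y) = (-1) ^ n * hermiteFun n y := by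
  have := congrArg (eval y) (monicHermite_comp_neg n)
  simp only [eval_comp, eval_neg, eval_X, eval_mul, eval_pow, eval_one] at this
  simp only [hermiteFun, polyGauss, this, even_two.neg_pow]
  ring

lemma continuous_hermiteFun (n : ℕ) : Continuous (hermiteFun n) := continuous_polyGauss _

lemma integrable_hermiteFun (n : ℕ) : Integrable (hermiteFun n) := integrable_polyGauss _

lemma eventually_hermiteFun_pos (n : ℕ) : ∀ᶠ y in atTop, 0 < hermiteFun n y := by
  have h : ∀ᶠ y in atTop, 0 < (monicHermite n).eval y := by
    obtain ⟨hm, hd⟩ := monicHermite_monic n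
    rcases Nat.eq_zero_or_pos n with rfl | hn
    · simp [monicHermite]
    · refine (tendsto_atTop_of_leadingCoeff_nonneg _ ?_ (by simp [hm.leadingCoeff])).eventually_gt_atTop 0
      rw [degree_eq_natDegree hm.ne_zero, hd]
      exact_mod_cast hn
  filter_upwards [h] with y hy
  exact mul_pos hy (Real.exp_pos _)

lemma integrable_hermiteFun_sq (n : ℕ) : Integrable fun y => hermiteFun n y ^ 2 := by
  refine Integrable.mono' (integrable_polyGauss (monicHermite n ^ 2))
    ((continuous_hermiteFun n).pow 2).aestronglyMeasurable (Eventually.of_forall fun y => ?_)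
  have h1 : Real.exp (-(1 / 2) * y ^ 2) ≤ 1 := Real.exp_le_one_iff.2 (by nlinarith [sq_nonneg y])
  have h0 := Real.exp_pos (-(1 / 2) * y ^ 2)
  rw [Real.norm_of_nonneg (by positivity), hermiteFun, polyGauss, polyGauss, eval_pow, mul_pow]
  gcongr
  nlinarith

end Hermite

/-! ### Shooting data uniform in `ε` and `μ` -/

/-- Families of solutions `F ε μ` of `f'' = (potential - μ) f` decaying at `+∞`, normalized at `R`
and close to the Hermite function on `[-R, R]`. -/
structure ShootingData (k n : ℕ) where
  (R ε₀ θ κ S₀ B : ℝ)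
  (F F' : ℝ → ℝ → ℝ → ℝ)
  R_pos : 0 < R
  ε₀_pos : 0 < ε₀
  θ_pos : 0 < θ
  S₀_pos : 0 < S₀
  hermite_pos : ∀ y, R ≤ y → 0 < hermiteFun n y
  κ_le : κ ≤ hermiteFun n R / 2
  lower : ∀ a b : ℝ → ℝ, Continuous a → Continuous b →
    (∀ y ∈ Icc (-R) R, |a y - hermiteFun n y| ≤ κ) →
    (∀ y ∈ Icc (-R) R, |b y - hermiteFun n y| ≤ κ) → S₀ ≤ ∫ y in Ioc (-R) R, a y * b y
  κ_nonneg : 0 ≤ κ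
  potential_ge : ∀ ε μ y, |ε| < ε₀ → |μ| ≤ θ → R ≤ |y| → 1 / 4 ≤ potential k n ε y - μ
  decaying : ∀ ε μ, |ε| < ε₀ → |μ| ≤ θ →
    IsDecaying (fun y => potential k n ε y - μ) R (F ε μ) (F' ε μ)
  normalized : ∀ ε μ, |ε| < ε₀ → |μ| ≤ θ → F ε μ R = hermiteFun n R
  close : ∀ ε μ, |ε| < ε₀ → |μ| ≤ θ → ∀ y ∈ Icc (-R) R, |F ε μ y - hermiteFun n y| ≤ κ
  bound : ∀ ε μ, |ε| < ε₀ → |μ| ≤ θ → ∀ y, -R ≤ y → |F ε μ y| ≤ B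
  continuousOn : ∀ ε, |ε| < ε₀ → ∀ y ∈ Icc (-R) R,
    ContinuousOn (fun μ => F ε μ y) (Icc (-θ) θ) ∧ ContinuousOn (fun μ => F' ε μ y) (Icc (-θ) θ)

/-- Products of functions close to `h` have integral close to that of `h²`. -/
lemma exists_integral_mul_lower {h : ℝ → ℝ} {R : ℝ} (hc : Continuous h) (hR : 0 < R)
    (hpos : 0 < h R) : ∃ S₀ > 0, ∃ κ₀ > 0, ∀ κ ≤ κ₀, ∀ a b : ℝ → ℝ, Continuous a → Continuous b →
    (∀ y ∈ Icc (-R) R, |a y - h y| ≤ κ) → (∀ y ∈ Icc (-R) R, |b y - h y| ≤ κ) →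
    S₀ ≤ ∫ y in Ioc (-R) R, a y * b y := by
  have hRR : -R ≤ R := by linarith
  set S := ∫ y in (-R)..R, h y ^ 2 with hS
  have hSpos : 0 < S := intervalIntegral.integral_pos (by linarith) (by fun_prop)
    (fun y _ => sq_nonneg _) ⟨R, right_mem_Icc.2 hRR, by positivity⟩
  set D := ∫ y in (-R)..R, (2 * |h y| + 1) with hD
  have hDpos : 0 ≤ D := intervalIntegral.integral_nonneg hRR fun y _ => by positivity
  refine ⟨S / 2, by positivity, min 1 (S / (2 * (D + 1))), lt_min one_pos (by positivity),
    fun κ hκ a b ha hb hah hbh => ?_⟩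
  have hκ1 : κ ≤ 1 := hκ.trans (min_le_left _ _)
  have hκ2 : κ * (2 * (D + 1)) ≤ S := (le_div_iff₀ (by positivity)).1 (hκ.trans (min_le_right _ _))
  have hκ0 : 0 ≤ κ := (abs_nonneg _).trans (hah R (right_mem_Icc.2 hRR))
  rw [← intervalIntegral.integral_of_le hRR]
  -- Expanding `a b` around `h²` costs at most `κ (2|h| + 1)`, the quadratic error being at most `κ`
  -- because `κ ≤ 1`.
  have h1 : ∫ y in (-R)..R, (h y ^ 2 - κ * (2 * |h y| + 1)) ≤ ∫ y in (-R)..R, a y * b y := by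
    refine intervalIntegral.integral_mono_on hRR
      (Continuous.intervalIntegrable (by fun_prop) _ _)
      (Continuous.intervalIntegrable (by fun_prop) _ _) fun y hy => ?_
    have e1 := hah y hy
    have e2 := hbh y hy
    have e3 : |h y * (a y - h y)| ≤ |h y| * κ := by rw [abs_mul]; gcongr
    have e4 : |h y * (b y - h y)| ≤ |h y| * κ := by rw [abs_mul]; gcongr
    have e5 : |(a y - h y) * (b y - h y)| ≤ κ * 1 := by
      rw [abs_mul]; exact mul_le_mul e1 (e2.trans hκ1) (abs_nonneg _) hκ0
    have : a y * b y = h y ^ 2 + h y * (a y - h y) + h y * (b y - h y)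
      + (a y - h y) * (b y - h y) := by ring
    rw [this]
    linarith [neg_abs_le (h y * (a y - h y)), neg_abs_le (h y * (b y - h y)),
      neg_abs_le ((a y - h y) * (b y - h y))]
  rw [intervalIntegral.integral_sub (Continuous.intervalIntegrable (by fun_prop) _ _)
    (Continuous.intervalIntegrable (by fun_prop) _ _), intervalIntegral.integral_const_mul,
    ← hS, ← hD] at h1
  nlinarith

open Polynomial in
/-- Decaying solutions depend Lipschitz continuously on the parameters at the oscillator. -/
lemma exists_closeness_bound {k : ℕ} (hk : 1 ≤ k) (n : ℕ) {R : ℝ} (hR : 0 < R)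
    (hh : IsDecaying (potential k n 0) R (hermiteFun n) (hermiteFun' n)) :
    ∃ C ≥ 0, ∀ ε μ : ℝ, |ε| ≤ 1 → |μ| ≤ 1 → ∀ f f' : ℝ → ℝ,
      IsDecaying (fun y => potential k n ε y - μ) R f f' → f R = hermiteFun n R →
      ∀ y ∈ Icc (-R) R, |f y - hermiteFun n y| ≤ C * (|ε| + |μ|) := by
  obtain ⟨T, hT⟩ := exists_potential_sub_bound hk n
  obtain ⟨G, hGi, hG⟩ := exists_integrable_bound (T * C (monicHermite n))
  obtain ⟨Bh, hBh⟩ := (isCompact_Icc (a := -R) (b := R)).exists_bound_of_continuousOn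
    (continuous_hermiteFun n).continuousOn
  obtain ⟨M₀, hM₀⟩ := (isCompact_Icc (a := -R) (b := R)).exists_bound_of_continuousOn
    (continuous_potential hk n 0).continuousOn
  have hTc : Continuous fun p : ℝ × ℝ => T.evalEval p.1 p.2 := by
    have : (fun p : ℝ × ℝ => T.evalEval p.1 p.2) = fun p : ℝ × ℝ =>
        ∑ i ∈ Finset.range (T.natDegree + 1), (T.coeff i).eval p.1 * p.2 ^ i := by
      ext p
      rw [evalEval, eval_eq_sum_range (p := T), eval_finsetSum]
      simp
    rw [this]
    fun_prop
  obtain ⟨BT, hBT⟩ := ((isCompact_Icc (a := -R) (b := R)).prod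
    (isCompact_Icc (a := (-1 : ℝ)) (b := 1))).exists_bound_of_continuousOn hTc.continuousOn
  have hmem : R ∈ Icc (-R) R := ⟨by linarith, le_rfl⟩
  have hBh0 : 0 ≤ Bh := (norm_nonneg _).trans (hBh R hmem)
  have hM₀0 : 0 ≤ M₀ := (norm_nonneg _).trans (hM₀ R hmem)
  have hBT0 : 0 ≤ BT := (norm_nonneg _).trans (hBT (R, 0) ⟨hmem, by norm_num⟩)
  have hGint : IntegrableOn (fun y => |G y| + |hermiteFun n y|) (Ioi R) :=
    (hGi.norm.add (integrable_hermiteFun n).norm).integrableOn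
  set I := ∫ y in Ioi R, (|G y| + |hermiteFun n y|)
  have hI : 0 ≤ I := integral_nonneg fun y => by positivity
  set C₁ := I + (BT + 1) * Bh
  have hC₁ : 0 ≤ C₁ := by positivity
  refine ⟨2 * C₁ * Real.exp ((M₀ + BT + 1 + 1) * (2 * R)), by positivity,
    fun ε μ hε hμ f f' hf hfR y hy => ?_⟩
  have hdiff : ∀ y, potential k n ε y - μ - potential k n 0 y = ε * T.evalEval y ε - μ :=
    fun y => by rw [← hT]; ring
  have hs : 0 ≤ |ε| + |μ| := by positivity
  have hTb : ∀ y ∈ Icc (-R) R, |T.evalEval y ε| ≤ BT := fun y hy =>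
    hBT (y, ε) ⟨hy, abs_le.1 hε⟩
  -- The difference of potentials grows polynomially, but it is only ever multiplied by the Hermite
  -- function, whose Gaussian makes it integrable.
  have hpt : ∀ y, R ≤ y → |potential k n ε y - μ - potential k n 0 y| * hermiteFun n y ≤
      (|ε| + |μ|) * (|G y| + |hermiteFun n y|) := fun y hy => by
    have h0 := (hh.pos y hy).le
    have hGy := hG ε y hε
    have e : polyGauss ((T * C (monicHermite n)).eval (C ε)) y =
        T.evalEval y ε * hermiteFun n y := by
      simp [polyGauss, hermiteFun, evalEval, mul_assoc]
    rw [e, abs_mul, abs_of_nonneg h0] at hGy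
    rw [hdiff, abs_of_nonneg h0]
    calc |ε * T.evalEval y ε - μ| * hermiteFun n y
        ≤ (|ε| * |T.evalEval y ε| + |μ|) * hermiteFun n y := by
          gcongr; rw [← abs_mul]; exact abs_sub _ _
      _ = |ε| * (|T.evalEval y ε| * hermiteFun n y) + |μ| * hermiteFun n y := by ring
      _ ≤ |ε| * |G y| + |μ| * hermiteFun n y := by gcongr; exact hGy.trans (le_abs_self _)
      _ ≤ (|ε| + |μ|) * (|G y| + hermiteFun n y) := by
          nlinarith [mul_nonneg (abs_nonneg ε) h0, mul_nonneg (abs_nonneg μ) (abs_nonneg (G y))]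
  have hc1 : Continuous fun y => potential k n ε y - μ :=
    (continuous_potential hk n ε).sub continuous_const
  have hc0 := continuous_potential hk n 0
  have hint : IntegrableOn
      (fun y => |potential k n ε y - μ - potential k n 0 y| * hermiteFun n y) (Ioi R) := by
    refine Integrable.mono' (hGint.const_mul (|ε| + |μ|))
      ((hc1.sub hc0).abs.mul hh.continuous).aestronglyMeasurable ?_
    filter_upwards [ae_restrict_mem measurableSet_Ioi] with y hy
    have hy' : R ≤ y := le_of_lt hy
    rw [Real.norm_of_nonneg (mul_nonneg (abs_nonneg _) (hh.pos y hy').le)]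
    exact hpt y hy'
  have hle : ∫ y in Ioi R, |potential k n ε y - μ - potential k n 0 y| * hermiteFun n y ≤
      (|ε| + |μ|) * I := by
    rw [← integral_const_mul]
    exact setIntegral_mono_on hint (hGint.const_mul _) measurableSet_Ioi
      fun y hy => hpt y (le_of_lt hy)
  have key := (IsDecaying.abs_sub_le (M := M₀ + BT + 1) (η := (|ε| + |μ|) * C₁) hc1 hc0 hf hh hfR
    hint ?_ ?_ (by positivity) (hle.trans ?_) hy).1
  · refine key.trans (le_of_eq (by ring))
  · intro y hy
    have e1 : |potential k n 0 y| ≤ M₀ := hM₀ y hy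
    have e2 : |ε * T.evalEval y ε| ≤ 1 * BT := by
      rw [abs_mul]; exact mul_le_mul hε (hTb y hy) (abs_nonneg _) zero_le_one
    have : potential k n ε y - μ = potential k n 0 y + ε * T.evalEval y ε - μ := by
      linarith [hdiff y]
    rw [this]
    have e3 := abs_sub (potential k n 0 y + ε * T.evalEval y ε) μ
    have e4 := abs_add_le (potential k n 0 y) (ε * T.evalEval y ε)
    linarith
  · intro y hy
    have e1 : |hermiteFun n y| ≤ Bh := hBh y hy
    have e2 : |ε * T.evalEval y ε - μ| ≤ (|ε| + |μ|) * (BT + 1) := by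
      refine (abs_sub _ _).trans ?_
      rw [abs_mul]
      have := mul_le_mul_of_nonneg_left (hTb y hy) (abs_nonneg ε)
      nlinarith [mul_nonneg (abs_nonneg μ) hBT0, abs_nonneg ε]
    rw [hdiff]
    calc _ ≤ (|ε| + |μ|) * (BT + 1) * Bh :=
          mul_le_mul e2 e1 (abs_nonneg _) (by positivity)
      _ ≤ _ := by simp only [C₁]; nlinarith
  · gcongr
    exact le_add_of_nonneg_right (by positivity)

/-- Continuous dependence of decaying solutions on the spectral parameter. -/
lemma exists_lipschitz_bound {q : ℝ → ℝ} (hq : Continuous q) {R μ₂ : ℝ} (hR : 0 < R)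
    {g g' : ℝ → ℝ} (hg : IsDecaying (fun y => q y - μ₂) R g g') :
    ∃ K, ∀ μ₁ : ℝ, |μ₁| ≤ 1 → ∀ f f' : ℝ → ℝ, IsDecaying (fun y => q y - μ₁) R f f' →
      f R = g R → ∀ y ∈ Icc (-R) R,
        |f y - g y| ≤ K * |μ₁ - μ₂| ∧ |f' y - g' y| ≤ K * |μ₁ - μ₂| := by
  obtain ⟨Bg, hBg⟩ := (isCompact_Icc (a := -R) (b := R)).exists_bound_of_continuousOn
    hg.continuous.continuousOn
  obtain ⟨M₀, hM₀⟩ := (isCompact_Icc (a := -R) (b := R)).exists_bound_of_continuousOn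
    hq.continuousOn
  have hBg0 : 0 ≤ Bg := (norm_nonneg _).trans (hBg R ⟨by linarith, le_rfl⟩)
  set I := ∫ y in Ioi R, g y
  have hI : 0 ≤ I := setIntegral_nonneg measurableSet_Ioi fun y hy => (hg.pos y (le_of_lt hy)).le
  refine ⟨2 * (I + Bg) * Real.exp ((M₀ + 1 + 1) * (2 * R)), fun μ₁ hμ₁ f f' hf hfR y hy => ?_⟩
  have hdiff : ∀ y, |q y - μ₁ - (q y - μ₂)| = |μ₁ - μ₂| := fun y => by
    rw [sub_sub_sub_cancel_left, abs_sub_comm]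
  have key := IsDecaying.abs_sub_le (q₁ := fun y => q y - μ₁) (q₂ := fun y => q y - μ₂)
    (M := M₀ + 1) (η := |μ₁ - μ₂| * (I + Bg))
    (hq.sub continuous_const) (hq.sub continuous_const) hf hg hfR
    (by simp only [hdiff]; exact hg.integrableOn.const_mul _)
    (fun y hy => (abs_sub _ _).trans (add_le_add (hM₀ y hy) hμ₁))
    (fun y hy => by
      rw [hdiff]
      gcongr
      exact (hBg y hy).trans (le_add_of_nonneg_left hI))
    (by positivity)
    (by
      simp only [hdiff]
      rw [integral_const_mul]
      gcongr
      exact le_add_of_nonneg_right hBg0) hy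
  exact ⟨key.1.trans (le_of_eq (by ring)), key.2.trans (le_of_eq (by ring))⟩

/-- `R` is taken beyond the region where the potential may be small and where the Hermite function
is positive; then `κ` is fixed, and finally `θ` and `ε₀` are shrunk to reach closeness `κ`. -/
theorem nonempty_shootingData {k : ℕ} (hk : 1 ≤ k) (n : ℕ) : Nonempty (ShootingData k n) := by
  obtain ⟨R₀, hR₀, ε₁, hε₁, hpot⟩ := exists_potential_lower_bound hk n
  obtain ⟨R, hhR, hR₀R⟩ := ((eventually_hermiteFun_pos n).and (eventually_ge_atTop R₀)).exists
  have hR : 0 < R := hR₀.trans_le hR₀R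
  have hh : IsDecaying (potential k n 0) R (hermiteFun n) (hermiteFun' n) :=
    IsDecaying.of_integrableOn_sq (c := 1 / 2) (continuous_potential hk n 0) (by norm_num)
      (fun y hy => hpot 0 y (by simpa) ((hR₀R.trans hy).trans (le_abs_self y)))
      (isSol_hermiteFun k n) (integrable_hermiteFun_sq n).integrableOn hhR
  obtain ⟨S₀, hS₀, κ₀, hκ₀, hlow⟩ := exists_integral_mul_lower (continuous_hermiteFun n) hR hhR
  obtain ⟨C, hC0, hC⟩ := exists_closeness_bound hk n hR hh
  obtain ⟨Bh, hBh⟩ := (isCompact_Icc (a := -R) (b := R)).exists_bound_of_continuousOn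
    (continuous_hermiteFun n).continuousOn
  -- The first bound keeps inner products on `[-R, R]` away from zero; the second keeps the left
  -- solution positive at `R`.
  set κ := min κ₀ (hermiteFun n R / 2) with hκ
  have hκp : 0 < κ := lt_min hκ₀ (by positivity)
  set ν := κ / (2 * (C + 1)) with hν
  have hνp : 0 < ν := by positivity
  have hCν : C * (ν + ν) ≤ κ := by
    have : 2 * (C + 1) * ν = κ := by rw [hν]; field_simp
    nlinarith
  -- The value `1 / 4` leaves `potential - μ ≥ 1/2 - 1/4` on the tails.
  set θ := min (1 / 4) ν with hθ
  set ε₀ := min (min ε₁ 1) ν with hε₀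
  have hε : ∀ ε, |ε| < ε₀ → |ε| < ε₁ ∧ |ε| ≤ 1 ∧ |ε| ≤ ν := fun ε h =>
    ⟨h.trans_le ((min_le_left _ _).trans (min_le_left _ _)),
      h.le.trans ((min_le_left _ _).trans (min_le_right _ _)), h.le.trans (min_le_right _ _)⟩
  have hμ : ∀ μ, |μ| ≤ θ → |μ| ≤ 1 / 4 ∧ |μ| ≤ ν := fun μ h =>
    ⟨h.trans (min_le_left _ _), h.trans (min_le_right _ _)⟩
  have hge : ∀ ε μ y, |ε| < ε₀ → |μ| ≤ θ → R ≤ |y| → 1 / 4 ≤ potential k n ε y - μ := by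
    intro ε μ y h1 h2 h3
    have := hpot ε y (hε ε h1).1 (hR₀R.trans h3)
    linarith [le_abs_self μ, (hμ μ h2).1]
  have hex : ∀ ε μ, ∃ f f' : ℝ → ℝ, |ε| < ε₀ → |μ| ≤ θ →
      IsDecaying (fun y => potential k n ε y - μ) R f f' ∧ f R = hermiteFun n R := by
    intro ε μ
    by_cases h : |ε| < ε₀ ∧ |μ| ≤ θ
    · obtain ⟨f, f', hf⟩ := IsDecaying.exists_isDecaying (R := R) (c := 1 / 4)
        ((continuous_potential hk n ε).sub (continuous_const (y := μ))) (by norm_num)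
        (fun y hy => hge ε μ y h.1 h.2 (hy.trans (le_abs_self y))) hhR
      exact ⟨f, f', fun _ _ => hf⟩
    · exact ⟨0, 0, fun h1 h2 => (h ⟨h1, h2⟩).elim⟩
  choose F F' hF using hex
  have hclose : ∀ ε μ, |ε| < ε₀ → |μ| ≤ θ → ∀ y ∈ Icc (-R) R,
      |F ε μ y - hermiteFun n y| ≤ κ := fun ε μ h1 h2 y hy => by
    refine (hC ε μ (hε ε h1).2.1 ((hμ μ h2).1.trans (by norm_num)) _ _ (hF ε μ h1 h2).1
      (hF ε μ h1 h2).2 y hy).trans (le_trans ?_ hCν)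
    gcongr
    · exact (hε ε h1).2.2
    · exact (hμ μ h2).2
  have hBh0 : 0 ≤ Bh := (norm_nonneg _).trans (hBh R ⟨by linarith, le_rfl⟩)
  refine ⟨{
    R := R, ε₀ := ε₀, θ := θ, κ := κ, S₀ := S₀, B := Bh + κ + hermiteFun n R, F := F, F' := F'
    R_pos := hR
    ε₀_pos := lt_min (lt_min hε₁ one_pos) hνp
    θ_pos := lt_min (by norm_num) hνp
    S₀_pos := hS₀
    hermite_pos := hh.pos
    κ_le := min_le_right _ _
    lower := fun a b => hlow κ (min_le_left _ _) a b
    κ_nonneg := hκp.le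
    potential_ge := hge
    decaying := fun ε μ h1 h2 => (hF ε μ h1 h2).1
    normalized := fun ε μ h1 h2 => (hF ε μ h1 h2).2
    close := hclose
    bound := fun ε μ h1 h2 y hy => ?_
    continuousOn := fun ε h1 y hy => ?_ }⟩
  · rcases le_total y R with hyR | hyR
    · have e1 := hclose ε μ h1 h2 y ⟨hy, hyR⟩
      have e2 : |hermiteFun n y| ≤ Bh := hBh y ⟨hy, hyR⟩
      have e3 := abs_sub_abs_le_abs_sub (F ε μ y) (hermiteFun n y)
      linarith
    · obtain ⟨hd, hn⟩ := hF ε μ h1 h2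
      rw [abs_of_pos (hd.pos y hyR)]
      have := hd.le y hyR
      linarith
  · have key : ∀ μ₂ ∈ Icc (-θ) θ, ∃ K, ∀ μ₁ ∈ Icc (-θ) θ,
        |F ε μ₁ y - F ε μ₂ y| ≤ K * |μ₁ - μ₂| ∧ |F' ε μ₁ y - F' ε μ₂ y| ≤ K * |μ₁ - μ₂| := by
      intro μ₂ hμ₂
      obtain ⟨hd₂, hn₂⟩ := hF ε μ₂ h1 (abs_le.2 hμ₂)
      obtain ⟨K, hK⟩ := exists_lipschitz_bound (continuous_potential hk n ε) hR hd₂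
      refine ⟨K, fun μ₁ hμ₁ => ?_⟩
      obtain ⟨hd₁, hn₁⟩ := hF ε μ₁ h1 (abs_le.2 hμ₁)
      exact hK μ₁ ((hμ μ₁ (abs_le.2 hμ₁)).1.trans (by norm_num)) _ _ hd₁ (hn₁.trans hn₂.symm) y hy
    constructor
    · exact continuousOn_of_pointwise_lipschitz fun x hx =>
        (key x hx).imp fun K hK z hz => (hK z hz).1
    · exact continuousOn_of_pointwise_lipschitz fun x hx =>
        (key x hx).imp fun K hK z hz => (hK z hz).2

/-! ### Eigenvalues -/

/-- `μ` is an eigenvalue of `-∂² + potential` on `L²(ℝ)`. -/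
def IsEigen (k n : ℕ) (ε μ : ℝ) : Prop :=
  ∃ φ φ', IsSol (fun y => potential k n ε y - μ) φ φ' ∧ Integrable (fun y => φ y ^ 2) ∧ φ ≠ 0

lemma IsSol.contDiff {q f f' : ℝ → ℝ} (hq : Continuous q) (h : IsSol q f f') :
    ContDiff ℝ 2 f := by
  have h1 : deriv f = f' := funext fun y => (h.deriv₁ y).deriv
  have h2 : deriv f' = fun y => q y * f y := funext fun y => (h.deriv₂ y).deriv
  have hf' : ContDiff ℝ 1 f' := by
    rw [contDiff_one_iff_deriv, h2]
    exact ⟨fun y => (h.deriv₂ y).differentiableAt, hq.mul h.continuous⟩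
  rw [show (2 : WithTop ℕ∞) = 1 + 1 by norm_num, contDiff_succ_iff_deriv, h1]
  exact ⟨fun y => (h.deriv₁ y).differentiableAt, by simp, hf'⟩

/-- At `z = 0` the argument of `b` is `0`, and `b(0) = 0`, so only the value `a(0) = 2n + 1`
survives. -/
lemma isEigenvalueB_zero_iff {k n : ℕ} (hk : 1 ≤ k) {a ζ : ℝ → ℝ} (ha0 : a 0 = 2 * (n : ℝ) + 1)
    (ε μ : ℝ) : IsEigenvalueB k a ζ 0 ε μ ↔ IsEigen k n ε μ := by
  have hop : ∀ φ y, opB k a ζ 0 ε φ y = -iteratedDeriv 2 φ y + potential k n ε y * φ y := by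
    intro φ y
    simp only [opB, bFun, (hasDerivAt_pFun hk ε y).deriv, potential, ← ha0]
    simp
  have hq : Continuous fun y => potential k n ε y - μ :=
    (continuous_potential hk n ε).sub continuous_const
  constructor
  · rintro ⟨φ, hφ, hL, hne, heq⟩
    refine ⟨φ, deriv φ, ⟨fun y => ?_, fun y => ?_⟩, hL.integrable_sq, hne⟩
    · exact (hφ.differentiable (by norm_num) y).hasDerivAt
    · have h1 : ContDiff ℝ 1 (deriv φ) := by
        rw [show (2 : WithTop ℕ∞) = 1 + 1 by norm_num, contDiff_succ_iff_deriv] at hφ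
        exact hφ.2.2
      refine (h1.differentiable (by norm_num) y).hasDerivAt.congr_deriv ?_
      have := heq y
      rw [hop, iteratedDeriv_succ, iteratedDeriv_one] at this
      linarith
  · rintro ⟨φ, φ', hs, hL, hne⟩
    refine ⟨φ, hs.contDiff hq,
      (memLp_two_iff_integrable_sq hs.continuous.aestronglyMeasurable).2 hL, hne, fun y => ?_⟩
    have h1 : deriv φ = φ' := funext fun y => (hs.deriv₁ y).deriv
    rw [hop, iteratedDeriv_succ, iteratedDeriv_one, h1, (hs.deriv₂ y).deriv]
    ring

lemma integrableOn_mul_and_abs_integral_le {φ v g : ℝ → ℝ} {s : Set ℝ} {B c : ℝ}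
    (hs : MeasurableSet s) (hφ : Continuous φ) (hv : Continuous v) (hg : Integrable g)
    (hg0 : ∀ y, 0 ≤ g y) (hc : 0 ≤ c) (hB : 0 ≤ B) (hφB : ∀ y ∈ s, |φ y| ≤ B)
    (hvg : ∀ y, |v y| ≤ c * g y) :
    IntegrableOn (fun y => φ y * v y) s ∧ |∫ y in s, φ y * v y| ≤ B * c * ∫ y, g y := by
  have hb : ∀ y ∈ s, ‖φ y * v y‖ ≤ B * c * g y := fun y hy => by
    rw [Real.norm_eq_abs, abs_mul, mul_assoc]
    exact mul_le_mul (hφB y hy) (hvg y) (abs_nonneg _) hB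
  have hi : IntegrableOn (fun y => φ y * v y) s :=
    Integrable.mono' (hg.integrableOn.const_mul (B * c)) (hφ.mul hv).aestronglyMeasurable
      ((ae_restrict_iff' hs).2 (Eventually.of_forall hb))
  refine ⟨hi, ?_⟩
  calc |∫ y in s, φ y * v y| ≤ ∫ y in s, B * c * g y :=
        (norm_integral_le_integral_norm _).trans
          (setIntegral_mono_on hi.norm (hg.integrableOn.const_mul _) hs hb)
    _ ≤ ∫ y, B * c * g y :=
        setIntegral_le_integral (hg.const_mul _) (Eventually.of_forall fun y =>
          mul_nonneg (mul_nonneg hB hc) (hg0 y))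
    _ = _ := integral_const_mul _ _

/-! ### Matching the solutions from the two ends -/

namespace ShootingData

variable {k n : ℕ} (S : ShootingData k n) {ε μ : ℝ}

/-- The solution decaying at `-∞`. -/
noncomputable def left (ε μ y : ℝ) : ℝ := (-1) ^ n * S.F (-ε) μ (-y)

/-- The derivative of `left`. -/
noncomputable def left' (ε μ y : ℝ) : ℝ := (-1) ^ n * -S.F' (-ε) μ (-y)

/-- The Wronskian at `R` of the solutions decaying at `-∞` and at `+∞`. -/
noncomputable def wronskian (ε μ : ℝ) : ℝ :=
  S.left ε μ S.R * S.F' ε μ S.R - S.left' ε μ S.R * S.F ε μ S.R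

lemma isSol_left (hε : |ε| < S.ε₀) (hμ : |μ| ≤ S.θ) :
    IsSol (fun y => potential k n ε y - μ) (S.left ε μ) (S.left' ε μ) := by
  have := ((S.decaying (-ε) μ (by rwa [abs_neg]) hμ).comp_neg).const_mul ((-1) ^ n)
  simp only [potential_neg_neg] at this
  exact this

/-- The factor `(-1) ^ n` in `left` matches the parity of the Hermite function, so the reflected
solution approximates it with the right sign. -/
lemma left_close (hε : |ε| < S.ε₀) (hμ : |μ| ≤ S.θ) {y : ℝ} (hy : y ∈ Icc (-S.R) S.R) :
    |S.left ε μ y - hermiteFun n y| ≤ S.κ := by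
  have := S.close (-ε) μ (by rwa [abs_neg]) hμ (-y) ⟨by linarith [hy.2], by linarith [hy.1]⟩
  have h1 : S.left ε μ y - hermiteFun n y =
      (-1) ^ n * (S.F (-ε) μ (-y) - hermiteFun n (-y)) := by
    have h2 : ((-1 : ℝ) ^ n) * (-1) ^ n = 1 := by rw [← mul_pow]; norm_num
    rw [left, hermiteFun_neg]
    linear_combination hermiteFun n y * h2
  rw [h1, abs_mul, abs_pow, abs_neg, abs_one, one_pow, one_mul]
  exact this

lemma abs_left (ε μ y : ℝ) : |S.left ε μ y| = |S.F (-ε) μ (-y)| := by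
  rw [left, abs_mul, abs_pow, abs_neg, abs_one, one_pow, one_mul]

lemma left_bound (hε : |ε| < S.ε₀) (hμ : |μ| ≤ S.θ) {y : ℝ} (hy : y ≤ S.R) :
    |S.left ε μ y| ≤ S.B := by
  rw [abs_left]
  exact S.bound (-ε) μ (by rwa [abs_neg]) hμ (-y) (by linarith)

lemma left_mul_left_pos (hε : |ε| < S.ε₀) {μ₁ μ₂ : ℝ} (hμ₁ : |μ₁| ≤ S.θ) (hμ₂ : |μ₂| ≤ S.θ)
    {y : ℝ} (hy : y ≤ -S.R) : 0 < S.left ε μ₁ y * S.left ε μ₂ y := by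
  have hε' : |-ε| < S.ε₀ := by rwa [abs_neg]
  have h1 := (S.decaying (-ε) μ₁ hε' hμ₁).pos (-y) (by linarith)
  have h2 := (S.decaying (-ε) μ₂ hε' hμ₂).pos (-y) (by linarith)
  have h3 : ((-1 : ℝ) ^ n) * (-1) ^ n = 1 := by rw [← mul_pow]; norm_num
  have : S.left ε μ₁ y * S.left ε μ₂ y = S.F (-ε) μ₁ (-y) * S.F (-ε) μ₂ (-y) := by
    rw [left, left]
    linear_combination (S.F (-ε) μ₁ (-y) * S.F (-ε) μ₂ (-y)) * h3
  rw [this]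
  positivity

lemma left_mul_hermiteFun_pos (hε : |ε| < S.ε₀) (hμ : |μ| ≤ S.θ) {y : ℝ} (hy : y ≤ -S.R) :
    0 < S.left ε μ y * hermiteFun n y := by
  have h1 := (S.decaying (-ε) μ (by rwa [abs_neg]) hμ).pos (-y) (by linarith)
  have h2 := S.hermite_pos (-y) (by linarith)
  have : S.left ε μ y * hermiteFun n y = S.F (-ε) μ (-y) * hermiteFun n (-y) := by
    rw [left, hermiteFun_neg]; ring
  rw [this]
  positivity

lemma tendsto_left (hε : |ε| < S.ε₀) (hμ : |μ| ≤ S.θ) :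
    Tendsto (S.left ε μ) atBot (𝓝 0) ∧ Tendsto (S.left' ε μ) atBot (𝓝 0) := by
  have hd := S.decaying (-ε) μ (by rwa [abs_neg]) hμ
  constructor
  · have := (hd.tendsto.comp tendsto_neg_atBot_atTop).const_mul ((-1) ^ n)
    rwa [mul_zero] at this
  · have := ((hd.tendsto'.comp tendsto_neg_atBot_atTop).neg).const_mul ((-1) ^ n)
    rwa [neg_zero, mul_zero] at this

lemma integrableOn_left (hε : |ε| < S.ε₀) (hμ : |μ| ≤ S.θ) :
    IntegrableOn (S.left ε μ) (Iio (-S.R)) ∧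
      IntegrableOn (fun y => S.left ε μ y ^ 2) (Iio (-S.R)) := by
  have hd := S.decaying (-ε) μ (by rwa [abs_neg]) hμ
  constructor
  · have h1 : IntegrableOn (fun y => S.F (-ε) μ (-y)) (Iio (-S.R)) :=
      IntegrableOn.comp_neg_Iio (by simpa using hd.integrableOn)
    exact Integrable.const_mul h1 _
  · have h1 := IntegrableOn.comp_neg_Iio (c := -S.R) (f := fun y => S.F (-ε) μ y ^ 2)
      (by simpa using hd.integrableOn_sq)
    refine h1.congr_fun (fun y _ => ?_) measurableSet_Iio
    rw [← sq_abs (S.left ε μ y), abs_left, sq_abs]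

lemma hermiteFun_R_pos : 0 < hermiteFun n S.R := S.hermite_pos _ le_rfl

lemma left_R_mem (hε : |ε| < S.ε₀) (hμ : |μ| ≤ S.θ) :
    hermiteFun n S.R / 2 ≤ S.left ε μ S.R ∧ S.left ε μ S.R ≤ 3 / 2 * hermiteFun n S.R := by
  have := abs_le.1 (S.left_close hε hμ (y := S.R) ⟨by linarith [S.R_pos], le_rfl⟩)
  have h2 := S.κ_le
  constructor <;> linarith

lemma integrable_of_tails {f : ℝ → ℝ} (hf : Continuous f) {R : ℝ}
    (h₁ : IntegrableOn f (Iio (-R))) (h₂ : IntegrableOn f (Ioi R)) : Integrable f := by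
  rw [← integrableOn_univ]
  have h3 : IntegrableOn f (Icc (-R) R) := hf.integrableOn_Icc
  refine ((h₁.union h3).union h₂).mono_set fun y _ => ?_
  simp only [mem_union, mem_Iio, mem_Icc, mem_Ioi]
  by_cases h : y < -R
  · exact Or.inl (Or.inl h)
  · by_cases h' : R < y
    · exact Or.inr h'
    · exact Or.inl (Or.inr ⟨not_lt.1 h, not_lt.1 h'⟩)

/-- A zero of the Wronskian is an eigenvalue. -/
theorem isEigen_of_wronskian_eq_zero (hk : 1 ≤ k) (hε : |ε| < S.ε₀) (hμ : |μ| ≤ S.θ)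
    (hW : S.wronskian ε μ = 0) : IsEigen k n ε μ := by
  have hq : Continuous fun y => potential k n ε y - μ :=
    (continuous_potential hk n ε).sub continuous_const
  have hd := S.decaying ε μ hε hμ
  have hl := S.isSol_left hε hμ
  have hp := hl.proportional hq hd.toIsSol (hd.pos S.R le_rfl).ne' hW
  have hlR := (S.left_R_mem hε hμ).1
  have hR := S.hermiteFun_R_pos
  refine ⟨S.left ε μ, S.left' ε μ, hl, integrable_of_tails (hl.continuous.pow 2)
    (S.integrableOn_left hε hμ).2 ?_, fun h0 => ?_⟩
  · refine Integrable.congr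
      (hd.integrableOn_sq.const_mul ((S.left ε μ S.R / S.F ε μ S.R) ^ 2))
      (Eventually.of_forall fun y => ?_)
    simp only [hp y, mul_pow]
  · rw [h0] at hlR
    simp only [Pi.zero_apply] at hlR
    linarith

/-- At an eigenvalue the two decaying solutions are positive multiples of each other. -/
theorem exists_pos_of_isEigen (hk : 1 ≤ k) (hε : |ε| < S.ε₀) (hμ : |μ| ≤ S.θ)
    (h : IsEigen k n ε μ) : ∃ d > 0, (∀ y, S.F ε μ y = d * S.left ε μ y) ∧
      ∀ y, S.F' ε μ y = d * S.left' ε μ y := by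
  obtain ⟨φ, φ', hφ, hL, hne⟩ := h
  have hε' : |-ε| < S.ε₀ := by rwa [abs_neg]
  have hq : ∀ ε, Continuous fun y => potential k n ε y - μ := fun ε =>
    (continuous_potential hk n ε).sub continuous_const
  have hd := S.decaying ε μ hε hμ
  have hd' := S.decaying (-ε) μ hε' hμ
  have hq0 : ∀ ε, |ε| < S.ε₀ → ∀ y, S.R ≤ y → 0 ≤ potential k n ε y - μ := fun ε hε y hy =>
    (by norm_num : (0 : ℝ) ≤ 1 / 4).trans
      (S.potential_ge ε μ y hε hμ (hy.trans (le_abs_self y)))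
  have h1 := IsDecaying.eq_const_mul (hq ε) (hq0 ε hε) hd hφ hL.integrableOn
  have hφn : IsSol (fun y => potential k n (-ε) y - μ) (fun y => φ (-y)) (fun y => -φ' (-y)) := by
    have := hφ.comp_neg
    have e : ∀ y, potential k n ε (-y) = potential k n (-ε) y := fun y => by
      rw [← potential_neg_neg, neg_neg]
    simpa only [e] using this
  have h2 := IsDecaying.eq_const_mul (hq (-ε)) (hq0 (-ε) hε') hd' hφn
    (hL.comp_neg.integrableOn)
  have hR := S.hermiteFun_R_pos
  rw [S.normalized ε μ hε hμ] at h1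
  rw [S.normalized (-ε) μ hε' hμ] at h2
  have hφR : φ S.R ≠ 0 := fun h0 => hne (funext fun y => by rw [h1 y, h0]; simp)
  have hsq : ((-1 : ℝ) ^ n) * (-1) ^ n = 1 := by rw [← mul_pow]; norm_num
  set d := (-1) ^ n * φ (-S.R) / φ S.R with hdd
  have hF : ∀ y, S.F ε μ y = d * S.left ε μ y := fun y => by
    have e1 := h1 y
    have e2 := h2 (-y)
    rw [neg_neg] at e2
    rw [e2] at e1
    rw [hdd, left]
    field_simp at e1 ⊢
    linear_combination -e1 - φ (-S.R) * S.F (-ε) μ (-y) * hsq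
  refine ⟨d, ?_, hF, fun y => ?_⟩
  · have hmem : -S.R ∈ Icc (-S.R) S.R := ⟨le_rfl, by linarith [S.R_pos]⟩
    have e1 := S.close ε μ hε hμ (-S.R) hmem
    have hl : S.left ε μ (-S.R) = (-1) ^ n * hermiteFun n S.R := by
      rw [left, neg_neg, S.normalized (-ε) μ hε' hμ]
    rw [hF, hl, hermiteFun_neg] at e1
    have e2 : d * ((-1) ^ n * hermiteFun n S.R) - (-1) ^ n * hermiteFun n S.R =
        (-1) ^ n * ((d - 1) * hermiteFun n S.R) := by ring
    rw [e2, abs_mul, abs_pow, abs_neg, abs_one, one_pow, one_mul, abs_mul, abs_of_pos hR] at e1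
    -- Closeness at `-R` reads `|d - 1| h(R) ≤ κ ≤ h(R) / 2`, which excludes `d ≤ 0`.
    have := S.κ_le
    by_contra! hdn
    have : 1 ≤ |d - 1| := by linarith [neg_abs_le (d - 1)]
    nlinarith
  · refine (hd.deriv₁ y).unique ?_
    have : S.F ε μ = fun y => d * S.left ε μ y := funext hF
    rw [this]
    exact ((S.isSol_left hε hμ).deriv₁ y).const_mul d

/-- There is at most one eigenvalue in `[-θ, θ]`. -/
theorem eigenvalue_unique (hk : 1 ≤ k) (hε : |ε| < S.ε₀) {μ₁ μ₂ : ℝ} (hμ₁ : |μ₁| ≤ S.θ)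
    (hμ₂ : |μ₂| ≤ S.θ) (h₁ : IsEigen k n ε μ₁) (h₂ : IsEigen k n ε μ₂) : μ₁ = μ₂ := by
  obtain ⟨d₁, hd₁, e₁, e₁'⟩ := S.exists_pos_of_isEigen hk hε hμ₁ h₁
  obtain ⟨d₂, hd₂, e₂, e₂'⟩ := S.exists_pos_of_isEigen hk hε hμ₂ h₂
  have hs₁ := S.decaying ε μ₁ hε hμ₁
  have hs₂ := S.decaying ε μ₂ hε hμ₂
  have hint₁ : Integrable (S.F ε μ₁) := integrable_of_tails hs₁.continuous
    (by rw [funext e₁]; exact (S.integrableOn_left hε hμ₁).1.const_mul d₁) hs₁.integrableOn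
  have hB₂ : ∀ y, ‖S.F ε μ₂ y‖ ≤ S.B + d₂ * S.B := fun y => by
    have hB0 : 0 ≤ S.B := (abs_nonneg _).trans (S.bound ε μ₂ hε hμ₂ (-S.R) le_rfl)
    rw [Real.norm_eq_abs]
    rcases le_total (-S.R) y with hy | hy
    · linarith [S.bound ε μ₂ hε hμ₂ y hy, mul_nonneg hd₂.le hB0]
    · rw [e₂, abs_mul, abs_of_pos hd₂]
      have := mul_le_mul_of_nonneg_left
        (S.left_bound hε hμ₂ (y := y) (by linarith [S.R_pos])) hd₂.le
      linarith
  have hint : Integrable fun y => S.F ε μ₁ y * S.F ε μ₂ y :=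
    hint₁.mul_bdd (c := S.B + d₂ * S.B) hs₂.continuous.aestronglyMeasurable (Eventually.of_forall hB₂)
  have htop : Tendsto (fun y => S.F ε μ₁ y * S.F' ε μ₂ y - S.F' ε μ₁ y * S.F ε μ₂ y) atTop
      (𝓝 0) := by
    simpa using (hs₁.tendsto.mul hs₂.tendsto').sub (hs₁.tendsto'.mul hs₂.tendsto)
  have hbot : Tendsto (fun y => S.F ε μ₁ y * S.F' ε μ₂ y - S.F' ε μ₁ y * S.F ε μ₂ y) atBot
      (𝓝 0) := by
    simp only [e₁, e₂, e₁', e₂']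
    obtain ⟨t₁, t₁'⟩ := S.tendsto_left hε hμ₁
    obtain ⟨t₂, t₂'⟩ := S.tendsto_left hε hμ₂
    simpa using ((t₁.const_mul d₁).mul (t₂'.const_mul d₂)).sub
      ((t₁'.const_mul d₁).mul (t₂.const_mul d₂))
  -- Orthogonality: the Wronskian of the two eigenfunctions vanishes at both ends, so `(μ₁ - μ₂)`
  -- times their inner product is zero.
  have key := integral_of_hasDerivAt_of_tendsto
    (fun y => (hs₁.hasDerivAt_wronskian hs₂.toIsSol y).congr_deriv
      (show _ = (μ₁ - μ₂) * (S.F ε μ₁ y * S.F ε μ₂ y) by ring)) (hint.const_mul _) hbot htop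
  rw [integral_const_mul, sub_zero] at key
  have hpos : 0 < ∫ y, S.F ε μ₁ y * S.F ε μ₂ y := by
    rw [← integral_add_compl (measurableSet_Ioc (a := -S.R) (b := S.R)) hint]
    have h1 := S.lower _ _ hs₁.continuous hs₂.continuous (S.close ε μ₁ hε hμ₁)
      (S.close ε μ₂ hε hμ₂)
    have h2 : 0 ≤ ∫ y in (Ioc (-S.R) S.R)ᶜ, S.F ε μ₁ y * S.F ε μ₂ y := by
      refine setIntegral_nonneg measurableSet_Ioc.compl fun y hy => ?_
      by_cases hyR : y ≤ -S.R
      · rw [e₁, e₂]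
        have := S.left_mul_left_pos hε hμ₁ hμ₂ hyR
        have : 0 ≤ d₁ * d₂ * (S.left ε μ₁ y * S.left ε μ₂ y) := by positivity
        linarith
      · have hyR' : S.R ≤ y := by
          by_contra! hlt
          exact hy ⟨not_le.1 hyR, hlt.le⟩
        exact mul_nonneg (hs₁.pos y hyR').le (hs₂.pos y hyR').le
    linarith [S.S₀_pos]
  rcases mul_eq_zero.1 key with h | h
  · linarith
  · linarith

open Polynomial in
/-- The Wronskian tested against a quasimode. -/
theorem wronskian_mul_quasimode (hε : |ε| < S.ε₀) (hμ : |μ| ≤ S.θ)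
    {P r : ℝ[X]} {μ₀ γ ρ : ℝ} {g : ℝ → ℝ} (hg : Integrable g) (hg0 : ∀ y, 0 ≤ g y)
    (hγ : 0 ≤ γ) (hρ : 0 ≤ ρ)
    (hP : ∀ y, HasDerivAt (polyGauss (derivative P - X * P))
      ((potential k n ε y - μ₀) * polyGauss P y - polyGauss r y) y)
    (hclose : ∀ y, |polyGauss P y - hermiteFun n y| ≤ γ * g y)
    (hr : ∀ y, |polyGauss r y| ≤ ρ * g y) :
    ∃ I J : ℝ, S.wronskian ε μ * polyGauss P S.R = (μ - μ₀) * I - J ∧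
      hermiteFun n S.R * (S.S₀ - 3 * (S.B * γ * ∫ y, g y)) ≤ I ∧
      |J| ≤ 3 * hermiteFun n S.R * (S.B * ρ * ∫ y, g y) := by
  have hd := S.decaying ε μ hε hμ
  have hl := S.isSol_left hε hμ
  set f := S.F ε μ
  set f' := S.F' ε μ
  set l := S.left ε μ with hldef
  set l' := S.left' ε μ
  set u := polyGauss P
  set u' := polyGauss (derivative P - X * P)
  set h := hermiteFun n with hh
  set R := S.R
  have hR : 0 < h R := S.hermiteFun_R_pos
  have hB : 0 ≤ S.B := (abs_nonneg _).trans (S.bound ε μ hε hμ (-R) le_rfl)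
  have hfB : ∀ y ∈ Ioi R, |f y| ≤ S.B := fun y hy =>
    S.bound ε μ hε hμ y (by linarith [mem_Ioi.1 hy, S.R_pos])
  have hlB : ∀ y ∈ Iic R, |l y| ≤ S.B := fun y hy => S.left_bound hε hμ hy
  have huc : Continuous u := continuous_polyGauss P
  have hhc : Continuous h := continuous_hermiteFun n
  have hrc : Continuous (polyGauss r) := continuous_polyGauss r
  have hhi : Integrable fun y => |h y| := (integrable_hermiteFun n).norm
  obtain ⟨fr, frb⟩ := integrableOn_mul_and_abs_integral_le measurableSet_Ioi hd.continuous hrc hg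
    hg0 hρ hB hfB hr
  obtain ⟨lr, lrb⟩ := integrableOn_mul_and_abs_integral_le measurableSet_Iic hl.continuous hrc hg
    hg0 hρ hB hlB hr
  obtain ⟨fd, fdb⟩ := integrableOn_mul_and_abs_integral_le measurableSet_Ioi hd.continuous
    (huc.sub hhc) hg hg0 hγ hB hfB hclose
  obtain ⟨ld, ldb⟩ := integrableOn_mul_and_abs_integral_le measurableSet_Iic hl.continuous
    (huc.sub hhc) hg hg0 hγ hB hlB hclose
  obtain ⟨fh, -⟩ := integrableOn_mul_and_abs_integral_le measurableSet_Ioi hd.continuous hhc hhi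
    (fun y => abs_nonneg _) zero_le_one hB hfB (fun y => by rw [one_mul])
  obtain ⟨lh, -⟩ := integrableOn_mul_and_abs_integral_le measurableSet_Iic hl.continuous hhc hhi
    (fun y => abs_nonneg _) zero_le_one hB hlB (fun y => by rw [one_mul])
  set E := S.B * γ * ∫ y, g y
  have hE : 0 ≤ E := mul_nonneg (mul_nonneg hB hγ) (integral_nonneg hg0)
  have fu_eq : (fun y => f y * u y) = fun y => f y * h y + f y * (u - h) y := by
    ext y; simp only [Pi.sub_apply]; ring
  have lu_eq : (fun y => l y * u y) = fun y => l y * h y + l y * (u - h) y := by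
    ext y; simp only [Pi.sub_apply]; ring
  have fu : IntegrableOn (fun y => f y * u y) (Ioi R) := by rw [fu_eq]; exact fh.add fd
  have lu : IntegrableOn (fun y => l y * u y) (Iic R) := by rw [lu_eq]; exact lh.add ld
  set I₁ := ∫ y in Ioi R, f y * u y with hI₁
  set I₂ := ∫ y in Iic R, l y * u y with hI₂
  set J₁ := ∫ y in Ioi R, f y * polyGauss r y
  set J₂ := ∫ y in Iic R, l y * polyGauss r y
  -- With `u` replaced by `h` both integrals have nonnegative integrands on the tails, and the piece
  -- on `(-R, R]` contributes at least `S₀`; `E` bounds each replacement error.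
  have I₁_ge : -E ≤ I₁ := by
    have h0 : 0 ≤ ∫ y in Ioi R, f y * h y := setIntegral_nonneg measurableSet_Ioi fun y hy =>
      mul_nonneg (hd.pos y (le_of_lt hy)).le (S.hermite_pos y (le_of_lt hy)).le
    rw [hI₁, fu_eq, integral_add fh fd]
    linarith [(abs_le.1 fdb).1]
  have I₂_ge : S.S₀ - E ≤ I₂ := by
    have h0 : S.S₀ ≤ ∫ y in Iic R, l y * h y := by
      have hRR : -R ≤ R := by linarith [S.R_pos]
      rw [← Iic_union_Ioc_eq_Iic hRR, setIntegral_union (Iic_disjoint_Ioc le_rfl)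
        measurableSet_Ioc (lh.mono_set (Iic_subset_Iic.2 hRR)) (lh.mono_set Ioc_subset_Iic_self)]
      have h1 := S.lower l h hl.continuous hhc (fun y hy => S.left_close hε hμ hy)
        (fun y _ => by rw [sub_self, abs_zero]; exact S.κ_nonneg)
      have h2 : 0 ≤ ∫ y in Iic (-R), l y * h y := setIntegral_nonneg measurableSet_Iic
        fun y hy => (S.left_mul_hermiteFun_pos hε hμ hy).le
      linarith
    rw [hI₂, lu_eq, integral_add lh ld]
    linarith [(abs_le.1 ldb).1]
  have hder : ∀ {v v' : ℝ → ℝ}, IsSol (fun y => potential k n ε y - μ) v v' → ∀ y,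
      HasDerivAt (fun y => v y * u' y - v' y * u y)
        ((μ - μ₀) * (v y * u y) - v y * polyGauss r y) y := fun hv y =>
    (((hv.deriv₁ y).mul (hP y)).sub ((hv.deriv₂ y).mul (hasDerivAt_polyGauss P y))).congr_deriv
      (by ring)
  have hA₁ : (μ - μ₀) * I₁ - J₁ = 0 - (f R * u' R - f' R * u R) := by
    rw [← integral_Ioi_of_hasDerivAt_of_tendsto' (fun y _ => hder hd.toIsSol y)
      ((fu.const_mul _).sub fr), integral_sub (fu.const_mul _) fr, integral_const_mul]
    simpa using (hd.tendsto.mul (tendsto_polyGauss_atTop (derivative P - X * P))).sub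
      (hd.tendsto'.mul (tendsto_polyGauss_atTop P))
  have hA₂ : (μ - μ₀) * I₂ - J₂ = (l R * u' R - l' R * u R) - 0 := by
    rw [← integral_Iic_of_hasDerivAt_of_tendsto' (fun y _ => hder hl y)
      ((lu.const_mul _).sub lr), integral_sub (lu.const_mul _) lr, integral_const_mul]
    obtain ⟨t, t'⟩ := S.tendsto_left hε hμ
    simpa using (t.mul (tendsto_polyGauss_atBot (derivative P - X * P))).sub
      (t'.mul (tendsto_polyGauss_atBot P))
  have hfR : f R = h R := S.normalized ε μ hε hμ
  obtain ⟨hl1, hl2⟩ := S.left_R_mem hε hμ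
  -- These weights cancel `u' R` between the two Green identities and leave the Wronskian times `u
  -- R`.
  refine ⟨l R * I₁ + f R * I₂, l R * J₁ + f R * J₂, ?_, ?_, ?_⟩
  · rw [wronskian]
    linear_combination -l R * hA₁ - f R * hA₂
  · rw [hfR]
    have hl0 : 0 ≤ l R := le_trans (by positivity) hl1
    have e1 : l R * -E ≤ l R * I₁ := mul_le_mul_of_nonneg_left I₁_ge hl0
    have e2 : h R * (S.S₀ - E) ≤ h R * I₂ := mul_le_mul_of_nonneg_left I₂_ge hR.le
    have e3 : l R * E ≤ 3 / 2 * h R * E := mul_le_mul_of_nonneg_right hl2 hE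
    nlinarith [mul_nonneg hR.le hE]
  · rw [hfR]
    have hl0 : 0 ≤ l R := le_trans (by positivity) hl1
    refine (abs_add_le _ _).trans ?_
    rw [abs_mul, abs_mul, abs_of_nonneg hl0, abs_of_pos hR]
    have hE' : 0 ≤ S.B * ρ * ∫ y, g y := mul_nonneg (mul_nonneg hB hρ) (integral_nonneg hg0)
    have e1 := mul_le_mul hl2 frb (abs_nonneg _) (by positivity)
    have e2 := mul_le_mul_of_nonneg_left lrb hR.le
    nlinarith [mul_nonneg hR.le hE']

lemma continuousOn_wronskian (hε : |ε| < S.ε₀) :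
    ContinuousOn (S.wronskian ε) (Icc (-S.θ) S.θ) := by
  have hR := S.R_pos
  have hε' : |-ε| < S.ε₀ := by rwa [abs_neg]
  have h1 := S.continuousOn ε hε S.R ⟨by linarith, le_rfl⟩
  have h2 := S.continuousOn (-ε) hε' (-S.R) ⟨le_rfl, by linarith⟩
  exact ((continuousOn_const.mul h2.1).mul h1.2).sub
    ((continuousOn_const.mul h2.2.neg).mul h1.1)

open Polynomial in
/-- Near every quasi-eigenvalue there is an eigenvalue. -/
theorem eventually_exists_eigenvalue (hk : 1 ≤ k) {m₀ : ℝ → ℝ} (hm : Continuous m₀)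
    (hm0 : m₀ 0 = 0) {N : ℕ} (hN : 1 ≤ N) {G : ℝ → ℝ} {P r : ℝ → ℝ[X]} (hG : Integrable G)
    (hG0 : ∀ y, 0 ≤ G y) (hquasi : ∀ ε : ℝ, |ε| ≤ 1 →
      (∀ y, HasDerivAt (polyGauss (derivative (P ε) - X * P ε))
        ((potential k n ε y - m₀ ε) * polyGauss (P ε) y - polyGauss (r ε) y) y) ∧
      (∀ y, |polyGauss (P ε) y - hermiteFun n y| ≤ |ε| * G y) ∧
      (∀ y, |polyGauss (r ε) y| ≤ |ε| ^ N * G y)) :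
    ∃ K, ∀ᶠ ε in 𝓝 (0 : ℝ), ∃ μ, |μ - m₀ ε| ≤ K * |ε| ^ N ∧ |μ| ≤ S.θ ∧ IsEigen k n ε μ := by
  set Γ := ∫ y, G y
  have hR := S.hermiteFun_R_pos
  have hB : 0 ≤ S.B := (abs_nonneg _).trans
    (S.bound 0 0 (by simpa using S.ε₀_pos) (by simpa using S.θ_pos.le) (-S.R) le_rfl)
  have hΓ : 0 ≤ Γ := integral_nonneg hG0
  have hS := S.S₀_pos
  -- Chosen so that, at distance `K |ε|^N` from `m₀ ε`, the main term `(μ - m₀) I` is at least the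
  -- bound on `|J|`, which fixes the sign of the Wronskian at both endpoints.
  set K := 6 * (S.B * Γ) / S.S₀ with hK
  have hK0 : 0 ≤ K := by positivity
  refine ⟨K, ?_⟩
  have hsmall : ∀ {φ : ℝ → ℝ} {c : ℝ}, Continuous φ → φ 0 < c → ∀ᶠ ε in 𝓝 (0 : ℝ), φ ε < c :=
    fun hφ hc => (hφ.tendsto 0).eventually_lt_const hc
  have hN0 : N ≠ 0 := by omega
  filter_upwards [hsmall (φ := fun ε => |ε|) continuous_abs (by simpa using S.ε₀_pos),
    hsmall (φ := fun ε => |ε|) continuous_abs (by simp : |(0 : ℝ)| < 1),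
    hsmall (φ := fun ε => 3 * (S.B * |ε| * Γ)) (c := S.S₀ / 2) (by fun_prop) (by simpa using hS),
    hsmall (φ := fun ε => |ε| * G S.R) (by fun_prop) (by simpa using hR),
    hsmall (φ := fun ε => |m₀ ε| + K * |ε| ^ N) (by fun_prop)
      (by simpa [hm0, hN0] using S.θ_pos)] with ε h1 h2 h3 h4 h5
  obtain ⟨q1, q2, q3⟩ := hquasi ε h2.le
  set s := K * |ε| ^ N with hs
  have hs0 : 0 ≤ s := by positivity
  have hmem : ∀ μ, |μ - m₀ ε| ≤ s → |μ| ≤ S.θ := fun μ h => by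
    have := abs_sub_abs_le_abs_sub μ (m₀ ε)
    linarith
  have hu : 0 < polyGauss (P ε) S.R := by
    have := (abs_le.1 (q2 S.R)).1
    linarith
  have hKs : hermiteFun n S.R * (S.S₀ / 2) * s =
      3 * hermiteFun n S.R * (S.B * |ε| ^ N * Γ) := by
    rw [hs, hK]; field_simp; ring
  have key : ∀ μ, |μ - m₀ ε| ≤ s → ∃ I J : ℝ,
      S.wronskian ε μ * polyGauss (P ε) S.R = (μ - m₀ ε) * I - J ∧
      hermiteFun n S.R * (S.S₀ / 2) ≤ I ∧ |J| ≤ hermiteFun n S.R * (S.S₀ / 2) * s := by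
    intro μ h
    obtain ⟨I, J, e1, e2, e3⟩ := S.wronskian_mul_quasimode h1 (hmem μ h) hG hG0 (abs_nonneg ε)
      (by positivity) q1 q2 q3
    refine ⟨I, J, e1, le_trans ?_ e2, e3.trans hKs.ge⟩
    gcongr
    linarith
  have hle : S.wronskian ε (m₀ ε - s) ≤ 0 := by
    obtain ⟨I, J, e1, e2, e3⟩ := key (m₀ ε - s) (by simp [abs_of_nonneg hs0])
    have : S.wronskian ε (m₀ ε - s) * polyGauss (P ε) S.R ≤ 0 := by
      rw [e1]
      nlinarith [(abs_le.1 e3).1]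
    by_contra! hlt
    nlinarith
  have hge : 0 ≤ S.wronskian ε (m₀ ε + s) := by
    obtain ⟨I, J, e1, e2, e3⟩ := key (m₀ ε + s) (by simp [abs_of_nonneg hs0])
    have : 0 ≤ S.wronskian ε (m₀ ε + s) * polyGauss (P ε) S.R := by
      rw [e1]
      nlinarith [(abs_le.1 e3).2]
    by_contra! hlt
    nlinarith
  have hsub : ∀ μ ∈ Icc (m₀ ε - s) (m₀ ε + s), |μ - m₀ ε| ≤ s := fun μ hμ =>
    abs_le.2 ⟨by linarith [hμ.1], by linarith [hμ.2]⟩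
  obtain ⟨μ, hμ, hW⟩ := intermediate_value_Icc (by linarith : m₀ ε - s ≤ m₀ ε + s)
    ((S.continuousOn_wronskian h1).mono fun μ hμ => abs_le.1 (hmem μ (hsub μ hμ))) ⟨hle, hge⟩
  exact ⟨μ, hsub μ hμ, hmem μ (hsub μ hμ),
    S.isEigen_of_wronskian_eq_zero hk h1 (hmem μ (hsub μ hμ)) hW⟩

end ShootingData

/-! ### Eigenvalue branch and its expansion -/

theorem lemma4p1 (k n : ℕ) (hk : 1 ≤ k) (a ζ : ℝ → ℝ) (δ₀ : ℝ) (hδ₀ : 0 < δ₀)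
    (ha : ContDiff ℝ ∞ a) (hζ : IsCutoff δ₀ ζ) (ha0 : a 0 = 2 * (n : ℝ) + 1) :
    ∃ θ : ℝ, 0 < θ ∧ ∃ ε₀ : ℝ, 0 < ε₀ ∧ ∃ lam : ℝ → ℝ,
      (∀ ε : ℝ, |ε| < ε₀ → ∀ μ : ℝ,
        (IsEigenvalueB k a ζ 0 ε μ ∧ |μ| ≤ θ) ↔ μ = lam ε) ∧
      ∃ Λ : ℕ → ℝ, HasAsymptoticExpansionAtZero lam Λ ∧
        Λ 1 = 0 ∧ Λ 2 = ((k : ℝ) - 1) * n * (n + 1) / 2 := by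
  obtain ⟨S⟩ := nonempty_shootingData hk n
  obtain ⟨Λ, hΛ0, hΛ1, hΛ2, hquasi⟩ := exists_quasimodes hk n
  have hexp : ∀ N, 1 ≤ N → ∃ K, ∀ᶠ ε in 𝓝 (0 : ℝ), ∃ μ,
      |μ - ∑ j ∈ Finset.range N, Λ j * ε ^ j| ≤ K * |ε| ^ N ∧ |μ| ≤ S.θ ∧ IsEigen k n ε μ := by
    intro N hN
    obtain ⟨G, P, r, hG, hG0, hq⟩ := hquasi N hN
    refine S.eventually_exists_eigenvalue hk
      (m₀ := fun ε => ∑ j ∈ Finset.range N, Λ j * ε ^ j) (by fun_prop) ?_ hN hG hG0 hq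
    obtain ⟨m, rfl⟩ := Nat.exists_eq_add_of_le' hN
    rw [Finset.sum_range_succ']
    simp [hΛ0]
  have hex : ∀ᶠ ε in 𝓝 (0 : ℝ), ∃ μ, |μ| ≤ S.θ ∧ IsEigen k n ε μ := by
    -- The lowest-order quasimode already gives existence; higher orders only sharpen the location.
    obtain ⟨K, hK⟩ := hexp 1 le_rfl
    filter_upwards [hK] with ε ⟨μ, _, h⟩ using ⟨μ, h⟩
  obtain ⟨ε₁, hε₁, hball⟩ := Metric.eventually_nhds_iff.1 hex
  have hex' : ∀ ε : ℝ, ∃ μ, |ε| < ε₁ → |μ| ≤ S.θ ∧ IsEigen k n ε μ := fun ε => by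
    by_cases h : |ε| < ε₁
    · obtain ⟨μ, hμ⟩ := hball (by simpa [Real.dist_eq] using h : dist ε 0 < ε₁)
      exact ⟨μ, fun _ => hμ⟩
    · exact ⟨0, fun h' => (h h').elim⟩
  choose lam hlam using hex'
  have hε₂ : 0 < min ε₁ S.ε₀ := lt_min hε₁ S.ε₀_pos
  have huniq : ∀ ε, |ε| < min ε₁ S.ε₀ → ∀ μ, |μ| ≤ S.θ → IsEigen k n ε μ → μ = lam ε :=
    fun ε hε μ h1 h2 => S.eigenvalue_unique hk (hε.trans_le (min_le_right _ _)) h1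
      (hlam ε (hε.trans_le (min_le_left _ _))).1 h2 (hlam ε (hε.trans_le (min_le_left _ _))).2
  have hev : ∀ᶠ ε in 𝓝 (0 : ℝ), |ε| < min ε₁ S.ε₀ :=
    (continuous_abs.tendsto (0 : ℝ)).eventually_lt_const (by simpa using hε₂)
  refine ⟨S.θ, S.θ_pos, min ε₁ S.ε₀, hε₂, lam, fun ε hε μ => ?_, Λ, fun N => ?_, hΛ1, hΛ2⟩
  · rw [isEigenvalueB_zero_iff hk ha0]
    constructor
    · rintro ⟨h1, h2⟩
      exact huniq ε hε μ h2 h1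
    · rintro rfl
      exact (hlam ε (hε.trans_le (min_le_left _ _))).symm
  -- Order zero is just boundedness by `θ`. For `N ≥ 1` the eigenvalue found near the
  -- quasi-eigenvalue must be `lam ε` by uniqueness, for `ε` in a neighbourhood depending on `N`.
  · rcases Nat.eq_zero_or_pos N with rfl | hN
    · refine Asymptotics.IsBigO.of_bound S.θ ?_
      filter_upwards [hev] with ε hε
      simpa using (hlam ε (hε.trans_le (min_le_left _ _))).1
    · obtain ⟨K, hK⟩ := hexp N hN
      refine Asymptotics.IsBigO.of_bound K ?_
      filter_upwards [hev, hK] with ε hε ⟨μ, h1, h2, h3⟩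
      rw [← huniq ε hε μ h2 h3, norm_pow, Real.norm_eq_abs, Real.norm_eq_abs]
      exact h1
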